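/- Let $E$ be a Euclidean space with inner product $\langle\cdot,\cdot\rangle$, let $\|\cdot\|$ be a norm on $E$ with unit ball $B=\{x:\|x\|\le 1\}$, and let $\|y\|_*=\max_{\|x\|\le1}\langle x,y\rangle$ be the conjugate norm. Let $\omega$ be a distance-generating function compatible with $\|\cdot\|$, that is, $\omega$ is continuously differentiable on $B$, $\langle\nabla\omega(x)-\nabla\omega(y),x-y\rangle\ge\|x-y\|^2$ for all $x,y\in B$, $\omega(0)=0$ and $\nabla\omega(0)=0$. Put $\Omega=\max_{\|x\|\le1}\sqrt{2\omega(x)}$. Let $X\subset E$ be a convex compact set and let $R$ be the smallest radius of a $\|\cdot\|$-ball containing $X$. Let $P$ be a Borel probability distribution on $\mathbf R^k$ with support $\Xi$, and let $F_i:E\times\Xi\to\mathbf R$, $0\le i\le m$, be Borel functions, convex in $x\in E$ and $P$-summable in $\xi$ for every $x\in E$. Put $f_i(x)=\int_\Xi F_i(x,\xi)\,P(d\xi)$ and $$L(x,\xi)=\max\left\{\|g-h\|_*:\ 0\le i\le m,\ g\in\partial_xF_i(x,\xi),\ h\in\partial f_i(x)\right\}.$$ Consider the problem $$\mathrm{Opt}=\min_{x\in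 X}\left[f_0(x):\ f_i(x)\le0,\ 1\le i\le m\right]$$ and the function $\Phi(r)=\min_{x\in X}\max[f_0(x)-r,f_1(x),\dots,f_m(x)]$. A real $\rho$ is said to $\epsilon$-underestimate $\mathrm{Opt}$ if $\rho\le\mathrm{Opt}$ and $\Phi(\rho)\le\epsilon$. Let $\tau_*=0.557409\ldots$ be the smallest positive real such that $e^t\le t+e^{\tau_*t^2}$ for all $t\in\mathbf R$. Assume that every $f_i$, $0\le i\le m$, is differentiable (as a function on $E$) at every point of $X$, that for some positive $M_1,M_2$ one has, for all $0\le i\le m$ and all $x\in X$, $$\mathbf E\left[e^{(F_i(x,\xi)-f_i(x))^2/M_1^2}\right]\le e,\qquad \mathbf E\left[e^{L^2(x,\xi)/M_2^2}\right]\le e\qquad(\xi\sim P),$$ and that the problem is feasible. Let $N\ge1$ be an integer, $s>1$, $\lambda,\mu\in[0,2\sqrt{\tau_*N}]$, and let $$\epsilon>2N^{-1/2}\left[\mu M_1+M_2R\left[\tfrac{\Omega}{2}(1+s^2)+\lambda\right]\right],\qquad \beta=e^{-N(s^2-1)}+e^{-\lambda^2/(4\tau_*)}+(m+2)e^{-\mu^2/(4\tau_*)}.$$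 Let $\xi_1,\dots,\xi_N$ be independent random vectors with distribution $P$, and let $f_{i,N}(x)=\frac1N\sum_{t=1}^NF_i(x,\xi_t)$. Then, with probability at least $1-\beta$, the optimal value $$\mathrm{Opt}_N=\min_{x\in X}\left[f_{0,N}(x)-\mu M_1N^{-1/2}:\ f_{i,N}(x)-\mu M_1N^{-1/2}\le0,\ 1\le i\le m\right]$$ (equal to $+\infty$ when this problem is infeasible, in which case it does not underestimate) $\epsilon$-underestimates $\mathrm{Opt}$. -/

import Mathlib

open MeasureTheory ProbabilityTheory Set

noncomputable section

namespace SAA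

/-- `τ_*`, the smallest positive real `τ` such that `e ^ t ≤ t + e ^ (τ t ^ 2)` for all real `t`. -/
def tauStar : ℝ :=
  sInf {τ : ℝ | 0 < τ ∧ ∀ t : ℝ, Real.exp t ≤ t + Real.exp (τ * t ^ 2)}

section Geometry

variable {E : Type*} [NormedAddCommGroup E] [InnerProductSpace ℝ E]

/-- The closed unit ball of the norm `p`. -/
def unitBall (p : Seminorm ℝ E) : Set E := {x | p x ≤ 1}

/-- The norm conjugate to `p` with respect to the inner product of `E`. -/
def dualNorm (p : Seminorm ℝ E) (y : E) : ℝ :=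
  sSup ((fun x => inner ℝ y x) '' unitBall p)

/-- `ω` is a distance-generating function compatible with the norm `p`: it is continuously
differentiable on the closed unit ball of `p`, strongly convex there with modulus one with
respect to `p`, and vanishes at the origin together with its derivative. -/
structure IsDistGen (p : Seminorm ℝ E) (ω : E → ℝ) : Prop where
  contDiffOn : ContDiffOn ℝ 1 ω (unitBall p)
  strong : ∀ x ∈ unitBall p, ∀ y ∈ unitBall p,
    p (x - y) ^ 2 ≤
      (fderivWithin ℝ ω (unitBall p) x - fderivWithin ℝ ω (unitBall p) y) (x - y)
  zero : ω 0 = 0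
  deriv_zero : fderivWithin ℝ ω (unitBall p) 0 = 0

/-- `Ω`, the maximum of `√(2 ω)` over the unit ball. -/
def Omega (p : Seminorm ℝ E) (ω : E → ℝ) : ℝ :=
  sSup ((fun x => √(2 * ω x)) '' unitBall p)

/-- The smallest radius of a `p`-ball that contains `X`. -/
def radius (p : Seminorm ℝ E) (X : Set E) : ℝ :=
  sInf {r : ℝ | 0 ≤ r ∧ ∃ c : E, ∀ x ∈ X, p (x - c) ≤ r}

/-- The subdifferential of `φ : E → ℝ` at `x`. -/
def subdiff (φ : E → ℝ) (x : E) : Set E :=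
  {g | ∀ y, φ x + inner ℝ g (y - x) ≤ φ y}

end Geometry

section Problem

variable {E : Type*} {m : ℕ}

/-- The feasible set of `min {g 0 x : x ∈ X, g i x ≤ 0, 1 ≤ i ≤ m}`. -/
def feasibleSet (X : Set E) (g : Fin (m + 1) → E → ℝ) : Set E :=
  {x | x ∈ X ∧ ∀ i : Fin m, g i.succ x ≤ 0}

/-- The optimal value of `min {g 0 x : x ∈ X, g i x ≤ 0, 1 ≤ i ≤ m}`, equal to `+∞` when the
problem is infeasible. -/
def optVal (X : Set E) (g : Fin (m + 1) → E → ℝ) : EReal :=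
  ⨅ x ∈ feasibleSet X g, (g 0 x : EReal)

/-- `Φ(r) = min_{x ∈ X} max [g 0 x - r, g 1 x, …, g m x]`. -/
def Phi (X : Set E) (g : Fin (m + 1) → E → ℝ) (r : ℝ) : ℝ :=
  sInf ((fun x => Finset.univ.sup' Finset.univ_nonempty
    (fun i : Fin (m + 1) => if i = 0 then g 0 x - r else g i x)) '' X)

/-- The real `ρ` `ε`-underestimates the optimal value of
`min {g 0 x : x ∈ X, g i x ≤ 0, 1 ≤ i ≤ m}`. -/
def Underestimates (X : Set E) (g : Fin (m + 1) → E → ℝ) (ε ρ : ℝ) : Prop :=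
  (ρ : EReal) ≤ optVal X g ∧ Phi X g ρ ≤ ε

end Problem

section Stochastic

variable {E : Type*} {k m : ℕ}

/-- The expectation functions `f i x = ∫ F i x ξ P(dξ)`. -/
def mean (P : Measure (EuclideanSpace ℝ (Fin k)))
    (F : Fin (m + 1) → E → EuclideanSpace ℝ (Fin k) → ℝ) (i : Fin (m + 1)) (x : E) : ℝ :=
  ∫ z, F i x z ∂P

/-- `L(x, ξ)`, the largest of `‖g - h‖_*` over `0 ≤ i ≤ m`, `g ∈ ∂ₓ F i (x, ξ)`,
`h ∈ ∂ f i (x)`. -/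
def lip [NormedAddCommGroup E] [InnerProductSpace ℝ E] (p : Seminorm ℝ E)
    (P : Measure (EuclideanSpace ℝ (Fin k)))
    (F : Fin (m + 1) → E → EuclideanSpace ℝ (Fin k) → ℝ)
    (x : E) (z : EuclideanSpace ℝ (Fin k)) : ℝ :=
  sSup {r : ℝ | ∃ i, ∃ g ∈ subdiff (fun y => F i y z) x, ∃ h ∈ subdiff (mean P F i) x,
    r = dualNorm p (g - h)}

/-- The sample averages `f i N (x) = (1 / N) ∑ t, F i x (ξ t)` of the sample `ζ = (ξ t)`. -/
def sampleMean {N : ℕ} (F : Fin (m + 1) → E → EuclideanSpace ℝ (Fin k) → ℝ)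
    (ζ : Fin N → EuclideanSpace ℝ (Fin k)) (i : Fin (m + 1)) (x : E) : ℝ :=
  (1 / (N : ℝ)) * ∑ t, F i x (ζ t)

end Stochastic

end SAA

end

/-! No uniform bound over `X` is needed: everything is controlled at two nonrandom points. Choose
`r` with `Phi X f r = ε`. Separation in the space of values gives weights `a` with `∑ a i * f i x -
a 0 * r ≥ ε` on `X` (`exists_multipliers`). Let `xs` solve the true problem and let `y` minimise `∑
a i * f i` over `X`; put `κ = μ M₁ / √N`.

If every sample mean at `xs` exceeds its expectation by at most `κ`, then `xs` is feasible for the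
shifted problem and `Opt_N ≤ Opt`. If the weighted sample mean at `y` is at most `κ` too low,
convexity carries this bound to all `x ∈ X`: linearise at `y` with random subgradients `g i`, whose
means are the gradients `h i` of `f i`. Optimality of `y` makes the mean slope nonnegative along `x
- y`, so the loss is at most `2 R / N` times the dual norm of the sum of the centred vectors `ζ = ∑
a i • (g i - h i)`. Were `Phi` at `Opt_N` above `ε`, then `Opt_N < r`, and a sample-feasible point
of value below `r` would contradict the multiplier inequality (`underestimates_of_close`).

The dual norm is bounded by the regret inequality of dual averaging with regulariser `ω`
(`IsDistGen.mul_dualNorm_sum_le`), which leaves a martingale sum, the `drift`, and a sum of squared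
norms. Chernoff bounds handle both (`measure_dualNorm_sum_tail`). Differentiability of `f i` at `y`
makes the random subgradients almost surely unique, hence measurable with the right mean
(`exists_seq_tendsto_inner_subdiff`). -/

namespace SAA

/-! ### The norm, its conjugate and the radius of a set. -/

section Norms

variable {E : Type*} [NormedAddCommGroup E] [InnerProductSpace ℝ E] {p : Seminorm ℝ E}

lemma zero_mem_unitBall : (0 : E) ∈ unitBall p := by simp [unitBall]

lemma convex_unitBall : Convex ℝ (unitBall p) := by
  have := p.convexOn.convex_le 1
  simpa [unitBall] using this

lemma dualNorm_le {y : E} {r : ℝ} (h : ∀ x ∈ unitBall p, inner ℝ y x ≤ r) :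
    dualNorm p y ≤ r :=
  csSup_le ⟨_, mem_image_of_mem _ zero_mem_unitBall⟩ (by rintro _ ⟨x, hx, rfl⟩; exact h x hx)

lemma radius_nonneg (X : Set E) : 0 ≤ radius p X := Real.sInf_nonneg fun _ h => h.1

variable [FiniteDimensional ℝ E]

lemma continuous_seminorm (p : Seminorm ℝ E) : Continuous p :=
  continuousOn_univ.1 (p.convexOn.continuousOn isOpen_univ)

lemma exists_pos_mul_norm_le (hp : ∀ x, p x = 0 → x = 0) :
    ∃ c : ℝ, 0 < c ∧ ∀ x, c * ‖x‖ ≤ p x := by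
  obtain hE | hE := subsingleton_or_nontrivial E
  · exact ⟨1, one_pos, fun x => by simp [Subsingleton.elim x 0]⟩
  have hc : IsCompact (Metric.sphere (0 : E) 1) := isCompact_sphere 0 1
  obtain ⟨x₀, hx₀, hmin⟩ := hc.exists_isMinOn (NormedSpace.sphere_nonempty.2 zero_le_one)
    (continuous_seminorm p).continuousOn
  have hx₀' : ‖x₀‖ = 1 := by simpa using hx₀
  have hpos : 0 < p x₀ := by
    refine lt_of_le_of_ne (apply_nonneg p x₀) fun h => ?_
    rw [hp x₀ h.symm] at hx₀'
    simp at hx₀'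
  refine ⟨p x₀, hpos, fun x => ?_⟩
  by_cases hx : x = 0
  · simp [hx]
  have hn : 0 < ‖x‖ := norm_pos_iff.2 hx
  have h1 : p x₀ ≤ p (‖x‖⁻¹ • x) := hmin (by simp [norm_smul, hn.ne'])
  rw [map_smul_eq_mul, norm_inv, norm_norm, inv_mul_eq_div, le_div_iff₀ hn] at h1
  exact h1

lemma isCompact_unitBall (hp : ∀ x, p x = 0 → x = 0) : IsCompact (unitBall p) := by
  obtain ⟨c, hc, h⟩ := exists_pos_mul_norm_le hp
  refine Metric.isCompact_of_isClosed_isBounded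
    (isClosed_le (continuous_seminorm p) continuous_const) ?_
  refine (Metric.isBounded_closedBall (x := (0 : E)) (r := 1 / c)).subset fun x hx => ?_
  have hx' : p x ≤ 1 := hx
  rw [mem_closedBall_zero_iff, le_div_iff₀ hc]
  linarith [h x]

lemma bddAbove_inner_unitBall (hp : ∀ x, p x = 0 → x = 0) (y : E) :
    BddAbove ((fun x => inner ℝ y x) '' unitBall p) :=
  (isCompact_unitBall hp).bddAbove_image (by fun_prop)

lemma inner_le_dualNorm (hp : ∀ x, p x = 0 → x = 0) (y : E) {x : E} (hx : x ∈ unitBall p) :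
    inner ℝ y x ≤ dualNorm p y :=
  le_csSup (bddAbove_inner_unitBall hp y) ⟨x, hx, rfl⟩

lemma dualNorm_nonneg (hp : ∀ x, p x = 0 → x = 0) (y : E) : 0 ≤ dualNorm p y := by
  simpa using inner_le_dualNorm hp y zero_mem_unitBall

lemma inner_le_dualNorm_mul (hp : ∀ x, p x = 0 → x = 0) (y x : E) :
    inner ℝ y x ≤ dualNorm p y * p x := by
  by_cases hx : p x = 0
  · simp [hp x hx]
  have hpos : 0 < p x := lt_of_le_of_ne (apply_nonneg p x) (Ne.symm hx)
  have := inner_le_dualNorm hp y (x := (p x)⁻¹ • x) (by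
    simp [unitBall, map_smul_eq_mul, abs_of_pos hpos, hx])
  rwa [inner_smul_right, inv_mul_eq_div, div_le_iff₀ hpos] at this

lemma dualNorm_smul (hp : ∀ x, p x = 0 → x = 0) {c : ℝ} (hc : 0 ≤ c) (y : E) :
    dualNorm p (c • y) ≤ c * dualNorm p y :=
  dualNorm_le fun x hx => by
    rw [inner_smul_left]
    exact mul_le_mul_of_nonneg_left (inner_le_dualNorm hp y hx) hc

lemma dualNorm_sum_le (hp : ∀ x, p x = 0 → x = 0) {ι : Type*} (s : Finset ι) (y : ι → E) :
    dualNorm p (∑ i ∈ s, y i) ≤ ∑ i ∈ s, dualNorm p (y i) :=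
  dualNorm_le fun x hx => by
    rw [sum_inner]
    exact Finset.sum_le_sum fun i _ => inner_le_dualNorm hp _ hx

lemma continuous_dualNorm (hp : ∀ x, p x = 0 → x = 0) : Continuous (dualNorm p) :=
  (isCompact_unitBall hp).continuous_sSup (f := fun y x : E => inner ℝ y x) (by
    unfold Function.HasUncurry.uncurry Function.hasUncurryInduction
    simp only [Function.HasUncurry.uncurry, id]
    fun_prop)

/-- Two points of `X` are at distance at most twice its radius. -/
lemma le_two_mul_radius {X : Set E} (hX : IsCompact X) {x y : E} (hx : x ∈ X) (hy : y ∈ X) :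
    p (x - y) ≤ 2 * radius p X := by
  have : p (x - y) / 2 ≤ radius p X := by
    refine le_csInf ?_ ?_
    · obtain ⟨C, hC⟩ := hX.bddAbove_image (continuous_seminorm p).continuousOn
      refine ⟨max C 0, le_max_right _ _, 0, fun z hz => ?_⟩
      rw [sub_zero]
      exact (hC ⟨z, hz, rfl⟩).trans (le_max_left _ _)
    · rintro r ⟨-, c, hc⟩
      have := map_add_le_add p (x - c) (c - y)
      rw [sub_add_sub_cancel, map_sub_rev p c y] at this
      linarith [hc x hx, hc y hy]
  linarith

end Norms

/-! ### Subgradients of finite convex functions. -/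

section Subgradients

variable {E : Type*} [NormedAddCommGroup E] [InnerProductSpace ℝ E]

/-- A hyperplane separates `(x, φ x)` from the open strict epigraph. Testing it directly above `x`
shows that it is not vertical, so its slope is a subgradient. -/
lemma subdiff_nonempty [FiniteDimensional ℝ E] {φ : E → ℝ} (hφ : ConvexOn ℝ univ φ) (x : E) :
    (subdiff φ x).Nonempty := by
  have hcont : Continuous φ := continuousOn_univ.1 (hφ.continuousOn isOpen_univ)
  have hopen : IsOpen {q : E × ℝ | q.1 ∈ univ ∧ φ q.1 < q.2} := by
    simpa using isOpen_lt (hcont.comp continuous_fst) continuous_snd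
  obtain ⟨L, hL⟩ := geometric_hahn_banach_open_point hφ.convex_strict_epigraph hopen
    (x := (x, φ x)) (by simp)
  have hsplit : ∀ y t, L (y, t) = L (y, 0) + t * L (0, 1) := fun y t => by
    rw [← smul_eq_mul, ← map_smul, ← map_add]; simp
  have hneg : L (0, 1) < 0 := by
    have := hL (x, φ x + 1) (by simp)
    rw [hsplit x, hsplit x (φ x)] at this
    linarith
  set a : ℝ := L (0, 1) with ha
  have hle : ∀ y, L (y, 0) + φ y * a ≤ L (x, 0) + φ x * a := fun y => by
    refine le_of_forall_pos_lt_add fun δ hδ => ?_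
    have := hL (y, φ y + δ / (-a)) (by simpa using div_pos hδ (neg_pos.2 hneg))
    rw [hsplit y, hsplit x (φ x)] at this
    have h2 : δ / (-a) * a = -δ := by
      rw [div_neg, neg_mul, div_mul_cancel₀ _ hneg.ne]
    nlinarith
  refine ⟨(InnerProductSpace.toDual ℝ E).symm ((-a)⁻¹ • L.comp (.inl ℝ E ℝ)), fun y => ?_⟩
  rw [InnerProductSpace.toDual_symm_apply]
  have h1 : L (y - x, 0) = L (y, 0) - L (x, 0) := by rw [← map_sub]; simp
  have h2 := hle y
  simp only [smul_apply, ContinuousLinearMap.comp_apply,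
    ContinuousLinearMap.inl_apply, smul_eq_mul, h1]
  have ha' : 0 < -a := neg_pos.2 hneg
  rw [inv_mul_eq_div, ← le_sub_iff_add_le', div_le_iff₀ ha']
  linarith

lemma inner_eq_fderiv_of_mem_subdiff {φ : E → ℝ} {x h : E} (hd : DifferentiableAt ℝ φ x)
    (hh : h ∈ subdiff φ x) (v : E) : inner ℝ h v = fderiv ℝ φ x v := by
  have hmin : IsLocalMin (fun y => φ y - inner ℝ h y) x := by
    refine Filter.Eventually.of_forall fun y => ?_
    have := hh y
    rw [inner_sub_right] at this
    simp only
    linarith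
  have hder : HasFDerivAt (fun y => φ y - inner ℝ h y) (fderiv ℝ φ x - innerSL ℝ h) x :=
    hd.hasFDerivAt.sub (innerSL ℝ h).hasFDerivAt
  have := DFunLike.congr_fun (hmin.hasFDerivAt_eq_zero hder) v
  simp only [sub_apply, innerSL_apply_apply,
    zero_apply] at this
  linarith

lemma eq_of_mem_subdiff {φ : E → ℝ} {x h h' : E} (hd : DifferentiableAt ℝ φ x)
    (hh : h ∈ subdiff φ x) (hh' : h' ∈ subdiff φ x) : h = h' :=
  ext_inner_right ℝ fun v => by
    rw [inner_eq_fderiv_of_mem_subdiff hd hh, inner_eq_fderiv_of_mem_subdiff hd hh']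

/-- With its mirror image below, this traps `⟪g, v⟫` between difference quotients that do not depend
on the choice of `g`. -/
lemma inner_le_quotient_of_mem_subdiff {φ : E → ℝ} {x g : E} (hg : g ∈ subdiff φ x) (v : E)
    {c : ℝ} (hc : 0 < c) : inner ℝ g v ≤ c * (φ (x + c⁻¹ • v) - φ x) := by
  have := hg (x + c⁻¹ • v)
  rw [add_sub_cancel_left, inner_smul_right, ← le_sub_iff_add_le', inv_mul_eq_div,
    div_le_iff₀ hc] at this
  linarith

lemma quotient_le_inner_of_mem_subdiff {φ : E → ℝ} {x g : E} (hg : g ∈ subdiff φ x) (v : E)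
    {c : ℝ} (hc : 0 < c) : c * (φ x - φ (x + c⁻¹ • -v)) ≤ inner ℝ g v := by
  have := inner_le_quotient_of_mem_subdiff hg (-v) hc
  rw [inner_neg_right] at this
  linarith

end Subgradients

end SAA

namespace SAA

/-! ### Consequences of strong convexity of `ω`. -/

section DualAveraging

variable {E : Type*} [NormedAddCommGroup E] [InnerProductSpace ℝ E]
  {p : Seminorm ℝ E} {ω : E → ℝ}

/-- The strong convexity inequality on the unit ball. -/
lemma IsDistGen.strong_convexity (hω : IsDistGen p ω) {u v : E}
    (hu : u ∈ unitBall p) (hv : v ∈ unitBall p) :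
    ω u + fderivWithin ℝ ω (unitBall p) u (v - u) + p (v - u) ^ 2 / 2 ≤ ω v := by
  set D := fderivWithin ℝ ω (unitBall p) with hD
  have hder : ∀ x ∈ unitBall p, HasFDerivWithinAt ω (D x) (unitBall p) x := fun x hx =>
    (hω.contDiffOn.differentiableOn one_ne_zero x hx).hasFDerivWithinAt
  have hline : ∀ t ∈ Icc (0 : ℝ) 1, u + t • (v - u) ∈ unitBall p := fun t ht =>
    convex_unitBall.add_smul_sub_mem hu hv ht
  set q := p (v - u) with hq
  -- Monotonicity of the derivative, applied to `u` and `u + t • (v - u)` and divided by `t`, says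
  -- that `ψ' ≥ 0`; the claim is `ψ 0 ≤ ψ 1`.
  let ψ : ℝ → ℝ := fun t => ω (u + t • (v - u)) - t * D u (v - u) - t ^ 2 / 2 * q ^ 2
  have hψ : ∀ t ∈ Icc (0 : ℝ) 1, HasDerivWithinAt ψ
      (D (u + t • (v - u)) (v - u) - D u (v - u) - t * q ^ 2) (Icc 0 1) t := fun t ht => by
    have h1 : HasDerivWithinAt (fun t : ℝ => u + t • (v - u)) (v - u) (Icc 0 1) t := by
      simpa using (((hasDerivAt_id t).smul_const (v - u)).const_add u).hasDerivWithinAt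
    have h2 := (hder _ (hline t ht)).comp_hasDerivWithinAt t h1 hline
    have h3 : HasDerivWithinAt (fun t : ℝ => t * D u (v - u)) (D u (v - u))
        (Icc 0 1) t := by
      simpa using ((hasDerivAt_id t).mul_const (D u (v - u))).hasDerivWithinAt
    have h4 : HasDerivWithinAt (fun t : ℝ => t ^ 2 / 2 * q ^ 2) (t * q ^ 2) (Icc 0 1) t := by
      have := ((((hasDerivAt_id t).pow 2).div_const 2).mul_const (q ^ 2)).hasDerivWithinAt
        (s := Icc 0 1)
      refine this.congr_deriv ?_
      simp
    exact (h2.sub h3).sub h4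
  have hmono : MonotoneOn ψ (Icc 0 1) := by
    refine monotoneOn_of_hasDerivWithinAt_nonneg (convex_Icc 0 1)
      (fun t ht => (hψ t ht).continuousWithinAt)
      (fun t ht => (hψ t (interior_subset ht)).mono interior_subset) fun t ht => ?_
    rw [interior_Icc] at ht
    have h1 := hω.strong _ (hline t ⟨ht.1.le, ht.2.le⟩) u hu
    rw [add_sub_cancel_left, map_smul_eq_mul, map_smul, smul_eq_mul, Real.norm_of_nonneg ht.1.le,
      mul_pow, sub_apply, ← hq, ← hD, sq t, mul_assoc] at h1
    have := le_of_mul_le_mul_left h1 ht.1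
    linarith
  have h01 := hmono (left_mem_Icc.2 zero_le_one) (right_mem_Icc.2 zero_le_one) zero_le_one
  simp only [ψ, zero_smul, one_smul, add_zero, add_sub_cancel, one_pow, zero_mul] at h01
  linarith

/-- At a maximiser of `⟪s, ·⟫ - ω` over the unit ball, this function has quadratic decay. -/
lemma IsDistGen.quadratic_growth (hω : IsDistGen p ω) {s u v : E}
    (hu : u ∈ unitBall p) (hmax : IsMaxOn (fun x => inner ℝ s x - ω x) (unitBall p) u)
    (hv : v ∈ unitBall p) :
    inner ℝ s v - ω v + p (v - u) ^ 2 / 2 ≤ inner ℝ s u - ω u := by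
  have hmin : IsLocalMinOn (fun x => ω x - inner ℝ s x) (unitBall p) u :=
    IsMinOn.localize fun x hx => by
      have := hmax hx
      simp only [mem_ofPred_eq] at this ⊢
      linarith
  have h1 := hmin.hasFDerivWithinAt_nonneg
    ((hω.contDiffOn.differentiableOn one_ne_zero u hu).hasFDerivWithinAt.sub
      (innerSL ℝ s).hasFDerivAt.hasFDerivWithinAt)
    (sub_mem_posTangentConeAt_of_segment_subset (convex_unitBall.segment_subset hu hv))
  have h2 := hω.strong_convexity hu hv
  simp only [sub_apply, innerSL_apply_apply, inner_sub_right] at h1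
  linarith

lemma IsDistGen.half_sq_le (hω : IsDistGen p ω) {v : E} (hv : v ∈ unitBall p) :
    p v ^ 2 / 2 ≤ ω v := by
  simpa [hω.zero, hω.deriv_zero] using hω.strong_convexity zero_mem_unitBall hv

lemma Omega_nonneg (p : Seminorm ℝ E) (ω : E → ℝ) : 0 ≤ Omega p ω :=
  Real.sSup_nonneg (by rintro _ ⟨x, -, rfl⟩; exact Real.sqrt_nonneg _)

variable [FiniteDimensional ℝ E]

lemma IsDistGen.le_half_sq_Omega (hp : ∀ x, p x = 0 → x = 0) (hω : IsDistGen p ω) {v : E}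
    (hv : v ∈ unitBall p) : ω v ≤ Omega p ω ^ 2 / 2 := by
  have h0 : 0 ≤ ω v := (by positivity : (0 : ℝ) ≤ p v ^ 2 / 2).trans (hω.half_sq_le hv)
  have hbdd : BddAbove ((fun x => √(2 * ω x)) '' unitBall p) :=
    (isCompact_unitBall hp).bddAbove_image
      (Real.continuous_sqrt.comp_continuousOn (hω.contDiffOn.continuousOn.const_mul 2))
  have h1 : √(2 * ω v) ≤ Omega p ω := le_csSup hbdd ⟨v, hv, rfl⟩
  have h2 := Real.sq_sqrt (by positivity : 0 ≤ 2 * ω v)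
  have h3 := pow_le_pow_left₀ (Real.sqrt_nonneg _) h1 2
  linarith

/-- Here the unit ball reduces to the origin. This case is treated apart because the step `γ`,
proportional to `Omega`, would vanish. -/
lemma IsDistGen.dualNorm_eq_zero_of_Omega_eq_zero (hp : ∀ x, p x = 0 → x = 0)
    (hω : IsDistGen p ω) (h : Omega p ω = 0) (y : E) : dualNorm p y = 0 := by
  refine le_antisymm (dualNorm_le fun x hx => ?_) (dualNorm_nonneg hp y)
  have h1 := (hω.half_sq_le hx).trans (hω.le_half_sq_Omega hp hx)
  rw [h] at h1
  have h2 : p x = 0 := by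
    have : p x ^ 2 = 0 := le_antisymm (by linarith) (sq_nonneg _)
    simpa using this
  simp [hp x h2]

/-- The maximiser of `⟪s, ·⟫ - ω` over the unit ball can be chosen to depend continuously
on `s`. -/
lemma IsDistGen.exists_mirror_map (hp : ∀ x, p x = 0 → x = 0) (hω : IsDistGen p ω) :
    ∃ u : E → E, Continuous u ∧ (∀ s, u s ∈ unitBall p) ∧ ∀ s, ∀ v ∈ unitBall p,
      inner ℝ s v - ω v + p (v - u s) ^ 2 / 2 ≤ inner ℝ s (u s) - ω (u s) := by
  have hex : ∀ s : E, ∃ u ∈ unitBall p, IsMaxOn (fun x => inner ℝ s x - ω x) (unitBall p) u :=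
    fun s => (isCompact_unitBall hp).exists_isMaxOn ⟨0, zero_mem_unitBall⟩
      (ContinuousOn.sub (by fun_prop) hω.contDiffOn.continuousOn)
  choose u hu hmax using hex
  have hgrow : ∀ s, ∀ v ∈ unitBall p,
      inner ℝ s v - ω v + p (v - u s) ^ 2 / 2 ≤ inner ℝ s (u s) - ω (u s) :=
    fun s v hv => hω.quadratic_growth (hu s) (hmax s) hv
  refine ⟨u, ?_, hu, hgrow⟩
  -- Adding the growth inequalities at `s` and `t` gives `p (u s - u t) ^ 2 ≤ ⟪s - t, u s - u t⟫`.
  have hlip : ∀ s t, p (u s - u t) ≤ dualNorm p (s - t) := fun s t => by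
    have h1 := hgrow s (u t) (hu t)
    have h2 := hgrow t (u s) (hu s)
    rw [map_sub_rev p (u t)] at h1
    have h3 := inner_le_dualNorm_mul hp (s - t) (u s - u t)
    simp only [inner_sub_left, inner_sub_right] at h3
    rcases (apply_nonneg p (u s - u t)).eq_or_lt with h0 | h0
    · rw [← h0]; exact dualNorm_nonneg hp _
    · refine le_of_mul_le_mul_right ?_ h0
      nlinarith
  obtain ⟨c, hc, hcp⟩ := exists_pos_mul_norm_le hp
  refine continuous_iff_continuousAt.2 fun t => tendsto_iff_norm_sub_tendsto_zero.2 ?_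
  have hlim : Filter.Tendsto (fun s => dualNorm p (s - t) / c) (nhds t) (nhds 0) := by
    have : Continuous fun s => dualNorm p (s - t) / c :=
      ((continuous_dualNorm hp).comp (continuous_id.sub continuous_const)).div_const c
    have h0 := this.tendsto t
    have hz : dualNorm p (0 : E) = 0 :=
      le_antisymm (dualNorm_le fun x _ => by simp) (dualNorm_nonneg hp 0)
    simpa [hz] using h0
  refine squeeze_zero (fun _ => norm_nonneg _) (fun s => ?_) hlim
  rw [le_div_iff₀ hc, mul_comm]
  exact (hcp _).trans (hlip s t)

end DualAveraging

/-! ### Regret of dual averaging. -/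

section Drift

variable {E : Type*} [NormedAddCommGroup E] [InnerProductSpace ℝ E]

/-- The sum of the increments `⟪y t, u (s + y 0 + ⋯ + y (t - 1))⟫` of a sequence `y` of
length `n`, for a strategy `u` that depends on the accumulated sum. -/
def drift (u : E → E) : (n : ℕ) → E → (Fin n → E) → ℝ
  | 0, _, _ => 0
  | n + 1, s, y => inner ℝ (y 0) (u s) + drift u n (s + y 0) (Fin.tail y)

/-- Makes the Chernoff bound for ordinary sums a special case of the one for drifts. -/
lemma drift_const (e : E) (n : ℕ) (s : E) (y : Fin n → E) :
    drift (fun _ => e) n s y = ∑ t, inner ℝ (y t) e := by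
  induction n generalizing s with
  | zero => simp [drift]
  | succ n ih => simp [drift, ih, Fin.sum_univ_succ, Fin.tail]

/-- Moves the step size from the data into the strategy, so that tail bounds apply to the unscaled
vectors. -/
lemma drift_smul (u : E → E) (γ : ℝ) (n : ℕ) (s : E) (y : Fin n → E) :
    drift u n (γ • s) (fun t => γ • y t) = γ * drift (fun s => u (γ • s)) n s y := by
  induction n generalizing s with
  | zero => simp [drift]
  | succ n ih =>
    have := ih (s + y 0) (Fin.tail y)
    rw [smul_add] at this
    simp only [drift, inner_smul_left, mul_add, ← this]
    rfl

variable [FiniteDimensional ℝ E] {p : Seminorm ℝ E}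

/-- The potential inequality of dual averaging. -/
lemma potential_le_drift (hp : ∀ x, p x = 0 → x = 0) {ω : E → ℝ} {u : E → E}
    (hgrow : ∀ s, ∀ v ∈ unitBall p,
      inner ℝ s v - ω v + p (v - u s) ^ 2 / 2 ≤ inner ℝ s (u s) - ω (u s))
    (n : ℕ) (s : E) (y : Fin n → E) {v : E} (hv : v ∈ unitBall p) (hu : ∀ s, u s ∈ unitBall p) :
    inner ℝ (s + ∑ t, y t) v - ω v ≤
      inner ℝ s (u s) - ω (u s) + drift u n s y + (∑ t, dualNorm p (y t) ^ 2) / 2 := by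
  induction n generalizing s with
  | zero =>
    have := hgrow s v hv
    simp only [Finset.univ_eq_empty, Finset.sum_empty, add_zero, drift, zero_div]
    nlinarith [sq_nonneg (p (v - u s))]
  | succ n ih =>
    have h1 := ih (s + y 0) (Fin.tail y)
    have h2 := hgrow s (u (s + y 0)) (hu _)
    have h3 := inner_le_dualNorm_mul hp (y 0) (u (s + y 0) - u s)
    rw [inner_sub_right] at h3
    simp only [Fin.sum_univ_succ, drift, ← add_assoc, Fin.tail] at h1 ⊢
    rw [inner_add_left s (y 0)] at h1
    -- By `a * b ≤ a ^ 2 / 2 + b ^ 2 / 2`, moving the maximiser costs half the squared dual norm of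
    -- `y 0`; the other half square is paid by the quadratic growth `h2`.
    nlinarith [sq_nonneg (dualNorm p (y 0) - p (u (s + y 0) - u s))]

/-- The regret bound of dual averaging with step `γ`. -/
lemma IsDistGen.mul_dualNorm_sum_le (hp : ∀ x, p x = 0 → x = 0) {ω : E → ℝ}
    (hω : IsDistGen p ω) {u : E → E}
    (hgrow : ∀ s, ∀ v ∈ unitBall p,
      inner ℝ s v - ω v + p (v - u s) ^ 2 / 2 ≤ inner ℝ s (u s) - ω (u s))
    (hu : ∀ s, u s ∈ unitBall p) {γ : ℝ} (hpos : 0 < γ) (n : ℕ) (y : Fin n → E) :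
    γ * dualNorm p (∑ t, y t) ≤ Omega p ω ^ 2 / 2 + drift u n 0 (fun t => γ • y t) +
      γ ^ 2 / 2 * ∑ t, dualNorm p (y t) ^ 2 := by
  have hsq : ∀ t, dualNorm p (γ • y t) ^ 2 ≤ γ ^ 2 * dualNorm p (y t) ^ 2 := fun t => by
    rw [← mul_pow]
    exact pow_le_pow_left₀ (dualNorm_nonneg hp _) (dualNorm_smul hp hpos.le _) 2
  have hsum := Finset.sum_le_sum fun t (_ : t ∈ Finset.univ) => hsq t
  rw [← Finset.mul_sum] at hsum
  have h0 : 0 ≤ ω (u 0) :=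
    (by positivity : (0 : ℝ) ≤ p (u 0) ^ 2 / 2).trans (hω.half_sq_le (hu 0))
  rw [mul_comm, ← le_div_iff₀ hpos]
  refine dualNorm_le fun v hv => ?_
  rw [le_div_iff₀ hpos]
  have h1 := potential_le_drift hp hgrow n 0 (fun t => γ • y t) hv hu
  have h2 := hω.le_half_sq_Omega hp hv
  rw [zero_add, ← Finset.smul_sum, inner_smul_left, inner_zero_left] at h1
  simp only [conj_trivial] at h1
  linarith

end Drift

end SAA

namespace SAA

/-! ### The constant `tauStar`. -/

section TauStar

lemma exp_le_add_exp_sq (t : ℝ) : Real.exp t ≤ t + Real.exp (t ^ 2) := by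
  rcases le_total |t| 1 with h | h
  · have h1 := (abs_le.1 (Real.abs_exp_sub_one_sub_id_le h)).2
    have h2 := Real.add_one_le_exp (t ^ 2)
    linarith
  · rcases le_abs'.1 h with h | h
    · have h1 : Real.exp t ≤ 1 := Real.exp_le_one_iff.2 (by linarith)
      have h2 := Real.add_one_le_exp (t ^ 2)
      nlinarith
    · have : Real.exp t ≤ Real.exp (t ^ 2) := Real.exp_le_exp.2 (by nlinarith)
      linarith

/-- At `t = 1` an admissible `τ` satisfies `exp τ ≥ e - 1 > 1.7`. -/
lemma tauStar_pos : 0 < tauStar := by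
  have hlog : 0 < Real.log (1.7 : ℝ) := Real.log_pos (by norm_num)
  refine hlog.trans_le (le_csInf ⟨1, one_pos, fun t => by simpa using exp_le_add_exp_sq t⟩ ?_)
  rintro τ ⟨-, hτ⟩
  have h1 := hτ 1
  have h2 := Real.exp_one_gt_d9
  rw [Real.log_le_iff_le_exp (by norm_num)]
  norm_num at h1
  linarith

/-- The infimum is attained: admissibility is inherited by larger `τ`, and one lets `τ` decrease to
`tauStar`. -/
lemma exp_le_add_exp_tauStar (t : ℝ) : Real.exp t ≤ t + Real.exp (tauStar * t ^ 2) := by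
  have hlim : Filter.Tendsto (fun τ : ℝ => t + Real.exp (τ * t ^ 2)) 
      (nhdsWithin tauStar (Ioi tauStar)) (nhds (t + Real.exp (tauStar * t ^ 2))) :=
    (Continuous.tendsto (by fun_prop) tauStar).mono_left nhdsWithin_le_nhds
  refine ge_of_tendsto hlim (eventually_nhdsWithin_of_forall fun τ hτ => ?_)
  obtain ⟨τ', ⟨-, hτ'⟩, hlt⟩ := exists_lt_of_csInf_lt
    (s := {τ : ℝ | 0 < τ ∧ ∀ t : ℝ, Real.exp t ≤ t + Real.exp (τ * t ^ 2)})
    ⟨1, one_pos, fun t => by simpa using exp_le_add_exp_sq t⟩ hτ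
  have h1 : Real.exp (τ' * t ^ 2) ≤ Real.exp (τ * t ^ 2) :=
    Real.exp_le_exp.2 (mul_le_mul_of_nonneg_right hlt.le (sq_nonneg t))
  linarith [hτ' t]

end TauStar

/-! ### Exponential moments of light-tailed variables. -/

section ExponentialMoments

variable {Z : Type*} [MeasurableSpace Z] {P : Measure Z}

lemma integrable_of_lintegral_ofReal_le {V : Z → ℝ} (hV : AEMeasurable V P) (h0 : ∀ z, 0 ≤ V z)
    {c : ℝ} (h : ∫⁻ z, ENNReal.ofReal (V z) ∂P ≤ ENNReal.ofReal c) : Integrable V P :=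
  (lintegral_ofReal_ne_top_iff_integrable hV.aestronglyMeasurable (.of_forall h0)).1
    (ne_top_of_le_ne_top ENNReal.ofReal_ne_top h)

lemma integral_le_of_lintegral_ofReal_le {V : Z → ℝ} (hV : AEMeasurable V P) (h0 : ∀ z, 0 ≤ V z)
    {c : ℝ} (hc : 0 ≤ c) (h : ∫⁻ z, ENNReal.ofReal (V z) ∂P ≤ ENNReal.ofReal c) :
    ∫ z, V z ∂P ≤ c := by
  rw [← ofReal_integral_eq_lintegral_ofReal (integrable_of_lintegral_ofReal_le hV h0 h)
    (.of_forall h0)] at h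
  exact (ENNReal.ofReal_le_ofReal_iff hc).1 h

/-- The moment generating function of a centred random variable with `E exp (Y² / M²) ≤ e`. -/
lemma lintegral_exp_mul_le [IsProbabilityMeasure P] {Y : Z → ℝ} (hint : Integrable Y P)
    (hY0 : ∫ z, Y z ∂P = 0) {M : ℝ}
    (hexp : ∫⁻ z, ENNReal.ofReal (Real.exp (Y z ^ 2 / M ^ 2)) ∂P ≤ ENNReal.ofReal (Real.exp 1))
    (hM : 0 < M) {θ : ℝ} (hθ : tauStar * θ ^ 2 * M ^ 2 ≤ 1) :
    ∫⁻ z, ENNReal.ofReal (Real.exp (θ * Y z)) ∂P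
      ≤ ENNReal.ofReal (Real.exp (tauStar * θ ^ 2 * M ^ 2)) := by
  set a := tauStar * θ ^ 2 * M ^ 2 with ha
  have ha0 : 0 ≤ a := by have := tauStar_pos; positivity
  have hmeas : AEMeasurable (fun z => Real.exp (Y z ^ 2 / M ^ 2)) P :=
    Real.measurable_exp.comp_aemeasurable ((hint.aemeasurable.pow_const 2).div_const _)
  have hVint := integrable_of_lintegral_ofReal_le hmeas (fun z => (Real.exp_pos _).le) hexp
  have hVle := integral_le_of_lintegral_ofReal_le hmeas (fun z => (Real.exp_pos _).le)
    (Real.exp_pos 1).le hexp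
  set V : Z → ℝ := fun z => Real.exp (Y z ^ 2 / M ^ 2)
  -- With `W = Y² / M²`, write `exp (a W) = exp a * exp (a (W - 1))` and bound the last factor by
  -- convexity, as `a ≤ 1`. Since `exp (W - 1)` has mean at most one, `G` has mean at most `exp a`.
  let G : Z → ℝ := fun z =>
    θ * Y z + Real.exp a * ((1 - a) + a * (Real.exp (-1) * V z))
  have hpt : ∀ z, Real.exp (θ * Y z) ≤ G z := fun z => by
    have h1 := exp_le_add_exp_tauStar (θ * Y z)
    have h2 := convexOn_exp.2 (mem_univ (0 : ℝ)) (mem_univ (Y z ^ 2 / M ^ 2 - 1))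
      (sub_nonneg.2 hθ) ha0 (by ring)
    simp only [smul_eq_mul, mul_zero, zero_add, Real.exp_zero, mul_one] at h2
    have h3 : tauStar * (θ * Y z) ^ 2 = a + a * (Y z ^ 2 / M ^ 2 - 1) := by
      rw [ha]; field_simp; ring
    rw [h3, Real.exp_add] at h1
    have h4 : Real.exp (Y z ^ 2 / M ^ 2 - 1) = Real.exp (-1) * V z := by
      rw [← Real.exp_add]; ring_nf
    rw [h4] at h2
    have h5 := mul_le_mul_of_nonneg_left h2 (Real.exp_pos a).le
    simp only [G]
    linarith
  have hi2 : Integrable (fun z => Real.exp a * ((1 - a) + a * (Real.exp (-1) * V z))) P :=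
    ((integrable_const _).add ((hVint.const_mul _).const_mul _)).const_mul _
  have hG : Integrable G P := (hint.const_mul θ).add hi2
  calc ∫⁻ z, ENNReal.ofReal (Real.exp (θ * Y z)) ∂P
      ≤ ∫⁻ z, ENNReal.ofReal (G z) ∂P :=
        lintegral_mono fun z => ENNReal.ofReal_le_ofReal (hpt z)
    _ = ENNReal.ofReal (∫ z, G z ∂P) := (ofReal_integral_eq_lintegral_ofReal hG
        (.of_forall fun z => (Real.exp_pos _).le.trans (hpt z))).symm
    _ ≤ _ := ENNReal.ofReal_le_ofReal ?_
  have hval : ∫ z, G z ∂P = Real.exp a * ((1 - a) + a * (Real.exp (-1) * ∫ z, V z ∂P)) := by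
    simp only [G]
    rw [integral_add (hint.const_mul θ) hi2, integral_const_mul, hY0, integral_const_mul,
      integral_add (integrable_const _) ((hVint.const_mul _).const_mul _), integral_const,
      integral_const_mul, integral_const_mul]
    simp
  rw [hval]
  have h1 : Real.exp (-1) * ∫ z, V z ∂P ≤ 1 := by
    have := mul_le_mul_of_nonneg_left hVle (Real.exp_pos (-1)).le
    rwa [← Real.exp_add, neg_add_cancel, Real.exp_zero] at this
  have h2 := mul_le_mul_of_nonneg_left h1 ha0
  exact mul_le_of_le_one_right (Real.exp_pos a).le (by linarith)

end ExponentialMoments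

/-! ### Tail bounds for drifts, sums and dual norms. -/

section DriftTail

variable {E : Type*} [NormedAddCommGroup E] [InnerProductSpace ℝ E] [FiniteDimensional ℝ E]
  [MeasurableSpace E] [BorelSpace E]

lemma measurable_drift {u : E → E} (hu : Measurable u) (n : ℕ) :
    Measurable fun q : E × (Fin n → E) => drift u n q.1 q.2 := by
  have : SecondCountableTopology E := by
    have := FiniteDimensional.proper_real E
    infer_instance
  induction n with
  | zero => simp only [drift]; exact measurable_const
  | succ n ih =>
    have h0 : Measurable fun q : E × (Fin (n + 1) → E) => q.2 0 :=
      (measurable_pi_apply 0).comp measurable_snd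
    have htail : Measurable fun q : E × (Fin (n + 1) → E) => Fin.tail q.2 :=
      measurable_pi_lambda _ fun i => (measurable_pi_apply i.succ).comp measurable_snd
    exact (h0.inner (hu.comp measurable_fst)).add
      (ih.comp ((measurable_fst.add h0).prodMk htail))

/-- Supermartingale argument by Fubini: integrate out all vectors but the first, using that the
inductive bound is uniform in the starting state `s + y 0`. -/
lemma lintegral_exp_drift_le {ν : Measure E} [IsProbabilityMeasure ν] {u : E → E}
    (hu : Measurable u) {θ : ℝ} {C : ENNReal}
    (hC : ∀ s, ∫⁻ y, ENNReal.ofReal (Real.exp (θ * inner ℝ y (u s))) ∂ν ≤ C) (n : ℕ) (s : E) :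
    ∫⁻ y, ENNReal.ofReal (Real.exp (θ * drift u n s y)) ∂(Measure.pi fun _ : Fin n => ν)
      ≤ C ^ n := by
  have : SecondCountableTopology E := by
    have := FiniteDimensional.proper_real E
    infer_instance
  induction n generalizing s with
  | zero => simp [drift]
  | succ n ih =>
    have hmeas : ∀ n s, Measurable fun y : Fin n → E =>
        ENNReal.ofReal (Real.exp (θ * drift u n s y)) := fun n s =>
      (Real.measurable_exp.comp
        (((measurable_drift hu n).comp measurable_prodMk_left).const_mul θ)).ennreal_ofReal
    have hpres := (measurePreserving_piFinSuccAbove (fun _ : Fin (n + 1) => ν) 0).symm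
    rw [← hpres.lintegral_comp (hmeas (n + 1) s), lintegral_prod]
    · have hsplit : ∀ (y₀ : E) (y : Fin n → E),
          ENNReal.ofReal (Real.exp (θ * drift u (n + 1) s
            ((MeasurableEquiv.piFinSuccAbove (fun _ : Fin (n + 1) => E) 0).symm (y₀, y))))
          = ENNReal.ofReal (Real.exp (θ * inner ℝ y₀ (u s))) *
            ENNReal.ofReal (Real.exp (θ * drift u n (s + y₀) y)) := fun y₀ y => by
        rw [← ENNReal.ofReal_mul (Real.exp_pos _).le, ← Real.exp_add, ← mul_add]
        simp [drift, MeasurableEquiv.piFinSuccAbove_symm_apply, Fin.insertNthEquiv]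
      simp only [hsplit]
      calc ∫⁻ y₀, ∫⁻ y, ENNReal.ofReal (Real.exp (θ * inner ℝ y₀ (u s))) *
              ENNReal.ofReal (Real.exp (θ * drift u n (s + y₀) y))
              ∂(Measure.pi fun _ : Fin n => ν) ∂ν
          ≤ ∫⁻ y₀, ENNReal.ofReal (Real.exp (θ * inner ℝ y₀ (u s))) * C ^ n ∂ν := by
            refine lintegral_mono fun y₀ => ?_
            rw [lintegral_const_mul _ (hmeas n _)]
            exact mul_le_mul_right (ih _) _
        _ ≤ C ^ (n + 1) := by
            rw [lintegral_mul_const, pow_succ']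
            · exact mul_le_mul_left (hC s) _
            · exact (Real.measurable_exp.comp
                ((measurable_id.inner measurable_const).const_mul θ)).ennreal_ofReal
    · exact ((hmeas (n + 1) s).comp (MeasurableEquiv.measurable _)).aemeasurable

variable {Z S : Type*} [MeasurableSpace Z] [MeasurableSpace S] {P : Measure Z}
  [IsProbabilityMeasure P] {Pr : Measure S}

/-- The Chernoff bound for the drift along an independent sample. -/
lemma measure_le_drift_le {n : ℕ} {ξ : Fin n → S → Z} (hlaw : ∀ t, HasLaw (ξ t) P Pr)
    (hindep : iIndepFun ξ Pr) {ζ : Z → E} (hζ : AEMeasurable ζ P) {u : E → E}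
    (hu : Measurable u) {θ b : ℝ} (hθ : 0 ≤ θ)
    (hb : ∀ s, ∫⁻ z, ENNReal.ofReal (Real.exp (θ * inner ℝ (ζ z) (u s))) ∂P
      ≤ ENNReal.ofReal (Real.exp b)) (r : ℝ) :
    Pr {w | r ≤ drift u n 0 fun t => ζ (ξ t w)} ≤ ENNReal.ofReal (Real.exp (n * b - θ * r)) := by
  have : SecondCountableTopology E := by
    have := FiniteDimensional.proper_real E
    infer_instance
  have hζ' : HasLaw ζ (P.map ζ) P := ⟨hζ, rfl⟩
  have hY : ∀ t, HasLaw (fun w => ζ (ξ t w)) (P.map ζ) Pr := fun t => hζ'.fun_comp (hlaw t)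
  have hprob : IsProbabilityMeasure (P.map ζ) := Measure.isProbabilityMeasure_map hζ
  have hYind : iIndepFun (fun t w => ζ (ξ t w)) Pr :=
    hindep.comp₀ (fun _ => ζ) (fun t => (hlaw t).aemeasurable)
      fun t => by rw [(hlaw t).map_eq]; exact hζ
  have hmap : Pr.map (fun w t => ζ (ξ t w)) = Measure.pi fun _ : Fin n => P.map ζ := by
    rw [hYind.map_fun_eq_pi_map fun t => (hY t).aemeasurable]
    congr 1
    funext t
    exact (hY t).map_eq
  have hdm : Measurable fun y : Fin n → E => drift u n 0 y :=
    (measurable_drift hu n).comp measurable_prodMk_left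
  have hset : MeasurableSet {y : Fin n → E | r ≤ drift u n 0 y} :=
    measurableSet_le measurable_const hdm
  have hb' : ∀ s, ∫⁻ y, ENNReal.ofReal (Real.exp (θ * inner ℝ y (u s))) ∂(P.map ζ)
      ≤ ENNReal.ofReal (Real.exp b) := fun s => by
    rw [lintegral_map' _ hζ]
    · exact hb s
    · exact (Real.measurable_exp.comp
        ((measurable_id.inner measurable_const).const_mul θ)).ennreal_ofReal.aemeasurable
  have h1 := lintegral_exp_drift_le hu hb' n 0
  have hpre : Pr {w | r ≤ drift u n 0 fun t => ζ (ξ t w)}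
      = (Measure.pi fun _ : Fin n => P.map ζ) {y | r ≤ drift u n 0 y} := by
    rw [← hmap, Measure.map_apply_of_aemeasurable
      (aemeasurable_pi_lambda _ fun t => (hY t).aemeasurable) hset]
    rfl
  rw [hpre]
  have h2 := meas_ge_le_lintegral_div (μ := Measure.pi fun _ : Fin n => P.map ζ)
    (Real.measurable_exp.comp (hdm.const_mul θ)).ennreal_ofReal.aemeasurable
    (ε := ENNReal.ofReal (Real.exp (θ * r)))
    (ENNReal.ofReal_pos.2 (Real.exp_pos _)).ne' ENNReal.ofReal_ne_top
  refine (measure_mono fun y (hy : r ≤ _) => ?_).trans (h2.trans ?_)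
  · exact ENNReal.ofReal_le_ofReal (Real.exp_le_exp.2 (mul_le_mul_of_nonneg_left hy hθ))
  · refine (ENNReal.div_le_div_right h1 _).trans_eq ?_
    rw [← ENNReal.ofReal_pow (Real.exp_pos _).le, ← ENNReal.ofReal_div_of_pos (Real.exp_pos _),
      ← Real.exp_nat_mul, ← Real.exp_sub]

/-- The Chernoff bound for sums along an independent sample. -/
lemma measure_le_sum_le {n : ℕ} {ξ : Fin n → S → Z} (hlaw : ∀ t, HasLaw (ξ t) P Pr)
    (hindep : iIndepFun ξ Pr) {Y : Z → ℝ} (hY : AEMeasurable Y P) {θ b : ℝ} (hθ : 0 ≤ θ)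
    (hb : ∫⁻ z, ENNReal.ofReal (Real.exp (θ * Y z)) ∂P ≤ ENNReal.ofReal (Real.exp b)) (r : ℝ) :
    Pr {w | r ≤ ∑ t, Y (ξ t w)} ≤ ENNReal.ofReal (Real.exp (n * b - θ * r)) := by
  have := measure_le_drift_le hlaw hindep hY (u := fun _ => (1 : ℝ)) measurable_const hθ
    (b := b) (fun _ => by simpa using hb) r
  simpa [drift_const] using this

/-- The tail bound for the drift of vectors with light tails. -/
lemma measure_drift_tail {n : ℕ} (hn : 1 ≤ n) {ξ : Fin n → S → Z}
    (hlaw : ∀ t, HasLaw (ξ t) P Pr) (hindep : iIndepFun ξ Pr) {ζ : Z → E}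
    (hζ : AEMeasurable ζ P) {u : E → E} (hu : Measurable u)
    (hint : ∀ v, Integrable (fun z => inner ℝ (ζ z) v) P)
    (hmean : ∀ v, ∫ z, inner ℝ (ζ z) v ∂P = 0) {M : ℝ} (hM : 0 < M)
    (hexp : ∀ s, ∫⁻ z, ENNReal.ofReal (Real.exp (inner ℝ (ζ z) (u s) ^ 2 / M ^ 2)) ∂P
      ≤ ENNReal.ofReal (Real.exp 1)) {lam : ℝ} (hlam : lam ∈ Icc 0 (2 * √(tauStar * n))) :
    Pr {w | lam * M * √(n : ℝ) ≤ drift u n 0 fun t => ζ (ξ t w)}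
      ≤ ENNReal.ofReal (Real.exp (-(lam ^ 2 / (4 * tauStar)))) := by
  have hτ := tauStar_pos
  have hn' : (0 : ℝ) < n := by exact_mod_cast hn
  have hsn : 0 < √(n : ℝ) := Real.sqrt_pos.2 hn'
  have hsq := Real.sq_sqrt hn'.le
  -- Minimises `n τ θ² M² - θ λ M √n`, with value `-λ² / (4 τ)`. The upper bound on `lam` is exactly
  -- the condition `τ θ² M² ≤ 1`.
  set θ := lam / (2 * tauStar * M * √(n : ℝ)) with hθ
  have hval : tauStar * θ ^ 2 * M ^ 2 = lam ^ 2 / (4 * tauStar * n) := by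
    rw [hθ, div_pow, mul_pow, hsq]; field_simp; ring
  have hle : lam ^ 2 / (4 * tauStar * n) ≤ 1 := by
    rw [div_le_one (by positivity)]
    have := pow_le_pow_left₀ hlam.1 hlam.2 2
    rw [mul_pow, Real.sq_sqrt (by positivity)] at this
    linarith
  have h := measure_le_drift_le hlaw hindep hζ hu (θ := θ) (div_nonneg hlam.1 (by positivity))
    (b := lam ^ 2 / (4 * tauStar * n)) (fun s => ?_) (lam * M * √(n : ℝ))
  · refine h.trans_eq ?_
    congr 2
    rw [hθ]; field_simp; ring
  · rw [← hval]
    exact lintegral_exp_mul_le (hint _) (hmean _) (hexp s) hM (hval ▸ hle)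

/-- The tail bound for sums of centred light-tailed variables. -/
lemma measure_sum_tail {n : ℕ} (hn : 1 ≤ n) {ξ : Fin n → S → Z}
    (hlaw : ∀ t, HasLaw (ξ t) P Pr) (hindep : iIndepFun ξ Pr) {Y : Z → ℝ}
    (hint : Integrable Y P) (hmean : ∫ z, Y z ∂P = 0) {M : ℝ} (hM : 0 < M)
    (hexp : ∫⁻ z, ENNReal.ofReal (Real.exp (Y z ^ 2 / M ^ 2)) ∂P ≤ ENNReal.ofReal (Real.exp 1))
    {lam : ℝ} (hlam : lam ∈ Icc 0 (2 * √(tauStar * n))) :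
    Pr {w | lam * M * √(n : ℝ) ≤ ∑ t, Y (ξ t w)}
      ≤ ENNReal.ofReal (Real.exp (-(lam ^ 2 / (4 * tauStar)))) := by
  have := measure_drift_tail hn hlaw hindep (ζ := Y) hint.aemeasurable (u := fun _ => (1 : ℝ))
    measurable_const (fun v => by simpa using hint.const_mul v)
    (fun v => by simp [integral_const_mul, hmean]) hM (fun _ => by simpa using hexp) hlam
  simpa [drift_const] using this

/-- The tail bound for the dual norm of a sum of independent light-tailed vectors. -/
lemma measure_dualNorm_sum_tail {p : Seminorm ℝ E} (hp : ∀ x, p x = 0 → x = 0) {ω : E → ℝ}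
    (hω : IsDistGen p ω) {n : ℕ} (hn : 1 ≤ n) {ξ : Fin n → S → Z}
    (hlaw : ∀ t, HasLaw (ξ t) P Pr) (hindep : iIndepFun ξ Pr) {ζ : Z → E}
    (hζ : AEMeasurable ζ P) (hint : ∀ v, Integrable (fun z => inner ℝ (ζ z) v) P)
    (hmean : ∀ v, ∫ z, inner ℝ (ζ z) v ∂P = 0) {M : ℝ} (hM : 0 < M)
    (hexp : ∫⁻ z, ENNReal.ofReal (Real.exp (dualNorm p (ζ z) ^ 2 / M ^ 2)) ∂P
      ≤ ENNReal.ofReal (Real.exp 1))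
    {lam : ℝ} (hlam : lam ∈ Icc 0 (2 * √(tauStar * n))) (s : ℝ) :
    Pr {w | M * √(n : ℝ) * (Omega p ω / 2 * (1 + s ^ 2) + lam)
        < dualNorm p (∑ t, ζ (ξ t w))}
      ≤ ENNReal.ofReal (Real.exp (-(n * (s ^ 2 - 1)))) +
        ENNReal.ofReal (Real.exp (-(lam ^ 2 / (4 * tauStar)))) := by
  have hn' : (0 : ℝ) < n := by exact_mod_cast hn
  have hsn : 0 < √(n : ℝ) := Real.sqrt_pos.2 hn'
  have hsq := Real.sq_sqrt hn'.le
  rcases (Omega_nonneg p ω).eq_or_lt with hΩ | hΩ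
  · have hempty : {w | M * √(n : ℝ) * (Omega p ω / 2 * (1 + s ^ 2) + lam)
        < dualNorm p (∑ t, ζ (ξ t w))} = ∅ := by
      refine eq_empty_of_forall_notMem fun w hw => ?_
      rw [mem_ofPred_eq] at hw
      rw [hω.dualNorm_eq_zero_of_Omega_eq_zero hp hΩ.symm, ← hΩ] at hw
      have := mul_nonneg (mul_nonneg hM.le hsn.le) hlam.1
      linarith
    rw [hempty, measure_empty]
    exact zero_le
  obtain ⟨u, hucont, hu, hgrow⟩ := hω.exists_mirror_map hp
  -- Balances `Ω² / (2 γ)` against `γ n M² / 2` in the regret bound.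
  set γ := Omega p ω / (M * √(n : ℝ)) with hγ
  have hγ0 : 0 < γ := by positivity
  have hucont' : Measurable fun x => u (γ • x) :=
    (hucont.comp (continuous_const_smul γ)).measurable
  have hd2 : AEMeasurable (fun z => dualNorm p (ζ z) ^ 2) P :=
    ((continuous_dualNorm hp).measurable.comp_aemeasurable hζ).pow_const 2
  have hA := measure_le_sum_le hlaw hindep hd2 (θ := 1 / M ^ 2) (b := 1) (by positivity)
    (by simpa only [one_div_mul_eq_div] using hexp) (s ^ 2 * n * M ^ 2)
  have hB := measure_drift_tail hn hlaw hindep hζ hucont' hint hmean hM (fun x => ?_) hlam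
  · have hA' : (n : ℝ) * 1 - 1 / M ^ 2 * (s ^ 2 * n * M ^ 2) = -(n * (s ^ 2 - 1)) := by
      field_simp; ring
    rw [hA'] at hA
    refine (measure_mono fun w hw => ?_).trans
      ((measure_union_le _ _).trans (add_le_add hA hB))
    rw [mem_ofPred_eq] at hw
    by_contra hcon
    simp only [mem_union, mem_ofPred_eq, not_or, not_le] at hcon
    obtain ⟨h1, h2⟩ := hcon
    have h3 := hω.mul_dualNorm_sum_le hp hgrow hu hγ0 n fun t => ζ (ξ t w)
    have h4 := drift_smul u γ n 0 fun t => ζ (ξ t w)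
    rw [smul_zero] at h4
    rw [h4] at h3
    have h5 := mul_lt_mul_of_pos_left hw hγ0
    have h6 := mul_lt_mul_of_pos_left h2 hγ0
    have h7 := mul_lt_mul_of_pos_left h1 (by positivity : 0 < γ ^ 2 / 2)
    have e1 : γ * (M * √(n : ℝ) * (Omega p ω / 2 * (1 + s ^ 2) + lam))
        = Omega p ω * (Omega p ω / 2 * (1 + s ^ 2) + lam) := by
      rw [hγ]; field_simp
    have e2 : γ * (lam * M * √(n : ℝ)) = Omega p ω * lam := by rw [hγ]; field_simp
    have e3 : γ ^ 2 / 2 * (s ^ 2 * n * M ^ 2) = Omega p ω ^ 2 / 2 * s ^ 2 := by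
      rw [hγ, div_pow, mul_pow, hsq]; field_simp
    rw [e1] at h5
    rw [e2] at h6
    rw [e3] at h7
    linarith
  · refine (lintegral_mono fun z => ENNReal.ofReal_le_ofReal (Real.exp_le_exp.2 ?_)).trans hexp
    refine div_le_div_of_nonneg_right ?_ (by positivity)
    refine sq_le_sq' ?_ (inner_le_dualNorm hp _ (hu _))
    have := inner_le_dualNorm hp (ζ z) (x := -u (γ • x)) (by simpa [unitBall] using hu (γ • x))
    rw [inner_neg_right] at this
    linarith

end DriftTail

end SAA

namespace SAA

/-! ### Subgradients of random convex functions. -/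

section RandomSubgradient

variable {E : Type*} [NormedAddCommGroup E] [InnerProductSpace ℝ E] [FiniteDimensional ℝ E]
  {Z : Type*} [MeasurableSpace Z] {P : Measure Z} {G : E → Z → ℝ}

/-- If the expectation of a random convex function is differentiable at a point, then a
sequence of difference quotients determines the random subgradients there almost surely, and
the expectation commutes with differentiation. -/
lemma exists_seq_tendsto_inner_subdiff (hconv : ∀ᵐ z ∂P, ConvexOn ℝ univ fun y => G y z)
    (hint : ∀ y, Integrable (G y) P) {x : E}
    (hd : DifferentiableAt ℝ (fun y => ∫ z, G y z ∂P) x) (v : E) :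
    ∃ U : ℕ → Z → ℝ, (∀ n, Integrable (U n) P) ∧
      (∀ᵐ z ∂P, ∀ g ∈ subdiff (fun y => G y z) x,
        Filter.Tendsto (fun n => U n z) Filter.atTop (nhds (inner ℝ g v))) ∧
      ∀ g : Z → E, (∀ᵐ z ∂P, g z ∈ subdiff (fun y => G y z) x) →
        Integrable (fun z => inner ℝ (g z) v) P ∧
        ∫ z, inner ℝ (g z) v ∂P = fderiv ℝ (fun y => ∫ z, G y z ∂P) x v := by
  set φ : E → ℝ := fun y => ∫ z, G y z ∂P with hφ
  let c : ℕ → ℝ := fun n => n + 1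
  have hc : ∀ n, 0 < c n := fun n => by positivity
  let U : ℕ → Z → ℝ := fun n z => c n * (G (x + (c n)⁻¹ • v) z - G x z)
  let L : ℕ → Z → ℝ := fun n z => c n * (G x z - G (x + (c n)⁻¹ • -v) z)
  have hUi : ∀ n, Integrable (U n) P := fun n => ((hint _).sub (hint _)).const_mul _
  have hLi : ∀ n, Integrable (L n) P := fun n => ((hint _).sub (hint _)).const_mul _
  have hctop : Filter.Tendsto (fun n => ‖c n‖) Filter.atTop Filter.atTop := by
    have : (fun n => ‖c n‖) = fun n : ℕ => (n : ℝ) + 1 :=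
      funext fun n => Real.norm_of_nonneg (hc n).le
    rw [this]
    exact Filter.tendsto_atTop_add_const_right _ _ tendsto_natCast_atTop_atTop
  have hUlim : Filter.Tendsto (fun n => ∫ z, U n z ∂P) Filter.atTop (nhds (fderiv ℝ φ x v)) := by
    refine (hd.hasFDerivAt.lim v hctop).congr fun n => ?_
    simp only [U, integral_const_mul, smul_eq_mul]
    rw [integral_sub (hint _) (hint _)]
  have hLlim : Filter.Tendsto (fun n => ∫ z, L n z ∂P) Filter.atTop (nhds (fderiv ℝ φ x v)) := by
    have := (hd.hasFDerivAt.lim (-v) hctop).neg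
    rw [map_neg, neg_neg] at this
    refine this.congr fun n => ?_
    simp only [L, integral_const_mul, smul_eq_mul]
    rw [integral_sub (hint _) (hint _)]
    ring
  have hDi : ∀ n, Integrable (fun z => U n z - L n z) P := fun n => (hUi n).sub (hLi n)
  have hDnn : ∀ᵐ z ∂P, ∀ n, 0 ≤ U n z - L n z := by
    filter_upwards [hconv] with z hz n
    obtain ⟨g, hg⟩ := subdiff_nonempty hz x
    have h1 := inner_le_quotient_of_mem_subdiff hg v (hc n)
    have h2 := quotient_le_inner_of_mem_subdiff hg v (hc n)
    simp only [U, L]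
    linarith
  -- The gap is nonnegative and both integrals tend to the same derivative, so it tends to zero in
  -- `L¹`, hence almost everywhere along a subsequence.
  have hDlim : Filter.Tendsto (fun n => eLpNorm ((fun z => U n z - L n z) - 0) 1 P)
      Filter.atTop (nhds 0) := by
    have h0 : Filter.Tendsto (fun n => ENNReal.ofReal (∫ z, U n z ∂P - ∫ z, L n z ∂P))
        Filter.atTop (nhds 0) := by
      have := ENNReal.tendsto_ofReal (hUlim.sub hLlim)
      simpa using this
    refine h0.congr fun n => ?_
    rw [sub_zero, eLpNorm_one_eq_lintegral_enorm, ← ofReal_integral_norm_eq_lintegral_enorm (hDi n),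
      ← integral_sub (hUi n) (hLi n)]
    congr 1
    refine integral_congr_ae ?_
    filter_upwards [hDnn] with z hz
    exact (Real.norm_of_nonneg (hz n)).symm
  obtain ⟨ns, -, hns⟩ := (tendstoInMeasure_of_tendsto_eLpNorm one_ne_zero
    (fun n => (hDi n).aestronglyMeasurable) aestronglyMeasurable_zero hDlim).exists_seq_tendsto_ae
  refine ⟨fun k => U (ns k), fun k => hUi _, ?_, fun g hg => ?_⟩
  · filter_upwards [hns] with z hz g hg
    rw [tendsto_iff_norm_sub_tendsto_zero]
    refine squeeze_zero (fun _ => norm_nonneg _) (fun k => ?_) hz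
    have h1 := inner_le_quotient_of_mem_subdiff hg v (hc (ns k))
    have h2 := quotient_le_inner_of_mem_subdiff hg v (hc (ns k))
    rw [Real.norm_eq_abs, abs_le]
    constructor <;> simp only [U, L] <;> linarith
  · have hle : ∀ n, ∀ᵐ z ∂P, L n z ≤ inner ℝ (g z) v ∧ inner ℝ (g z) v ≤ U n z := fun n => by
      filter_upwards [hg] with z hz
      exact ⟨quotient_le_inner_of_mem_subdiff hz v (hc n),
        inner_le_quotient_of_mem_subdiff hz v (hc n)⟩
    -- The selection `g` is arbitrary; measurability comes from its being an almost everywhere limit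
    -- of the `U (ns k)`.
    have hmeas : AEMeasurable (fun z => inner ℝ (g z) v) P := by
      refine aemeasurable_of_tendsto_metrizable_ae Filter.atTop
        (fun k => (hUi (ns k)).aemeasurable) ?_
      filter_upwards [hns, hg] with z hz hgz
      rw [tendsto_iff_norm_sub_tendsto_zero]
      refine squeeze_zero (fun _ => norm_nonneg _) (fun k => ?_) hz
      have h1 := inner_le_quotient_of_mem_subdiff hgz v (hc (ns k))
      have h2 := quotient_le_inner_of_mem_subdiff hgz v (hc (ns k))
      rw [Real.norm_eq_abs, abs_le]
      constructor <;> simp only [U, L] <;> linarith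
    have hgi : Integrable (fun z => inner ℝ (g z) v) P := by
      refine ((hLi 0).abs.add (hUi 0).abs).mono' hmeas.aestronglyMeasurable ?_
      filter_upwards [hle 0] with z hz
      rw [Real.norm_eq_abs, Pi.add_apply]
      refine abs_le.2 ⟨?_, ?_⟩
      · linarith [neg_abs_le (L 0 z), abs_nonneg (U 0 z)]
      · linarith [le_abs_self (U 0 z), abs_nonneg (L 0 z)]
    refine ⟨hgi, le_antisymm ?_ ?_⟩
    · exact ge_of_tendsto' hUlim fun n => integral_mono_ae hgi (hUi n) ((hle n).mono fun _ h => h.2)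
    · exact le_of_tendsto' hLlim fun n => integral_mono_ae (hLi n) hgi ((hle n).mono fun _ h => h.1)

lemma ae_subdiff_subsingleton (hconv : ∀ᵐ z ∂P, ConvexOn ℝ univ fun y => G y z)
    (hint : ∀ y, Integrable (G y) P) {x : E}
    (hd : DifferentiableAt ℝ (fun y => ∫ z, G y z ∂P) x) :
    ∀ᵐ z ∂P, (subdiff (fun y => G y z) x).Subsingleton := by
  let b := stdOrthonormalBasis ℝ E
  have h : ∀ᵐ z ∂P, ∀ j, ∀ g ∈ subdiff (fun y => G y z) x, ∀ g' ∈ subdiff (fun y => G y z) x,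
      inner ℝ g (b j) = inner ℝ g' (b j) := by
    refine ae_all_iff.2 fun j => ?_
    obtain ⟨U, -, hU, -⟩ := exists_seq_tendsto_inner_subdiff hconv hint hd (b j)
    filter_upwards [hU] with z hz g hg g' hg'
    exact tendsto_nhds_unique (hz g hg) (hz g' hg')
  filter_upwards [h] with z hz g hg g' hg'
  rw [← b.sum_repr' g, ← b.sum_repr' g']
  refine Finset.sum_congr rfl fun j _ => ?_
  rw [real_inner_comm, hz j g hg g' hg', real_inner_comm]

lemma aemeasurable_of_mem_subdiff [MeasurableSpace E] [BorelSpace E]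
    (hconv : ∀ᵐ z ∂P, ConvexOn ℝ univ fun y => G y z)
    (hint : ∀ y, Integrable (G y) P) {x : E}
    (hd : DifferentiableAt ℝ (fun y => ∫ z, G y z ∂P) x) {g : Z → E}
    (hg : ∀ᵐ z ∂P, g z ∈ subdiff (fun y => G y z) x) : AEMeasurable g P := by
  let b := stdOrthonormalBasis ℝ E
  have : g = fun z => ∑ j, inner ℝ (g z) (b j) • b j := funext fun z =>
    (b.sum_repr' (g z)).symm.trans (Finset.sum_congr rfl fun j _ => by rw [real_inner_comm])
  have : SecondCountableTopology E := by
    have := FiniteDimensional.proper_real E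
    infer_instance
  rw [‹g = _›]
  refine Finset.aemeasurable_fun_sum _ fun j _ => ?_
  obtain ⟨U, -, -, h⟩ := exists_seq_tendsto_inner_subdiff hconv hint hd (b j)
  exact (h g hg).1.aemeasurable.smul_const _

end RandomSubgradient

/-! ### Multipliers by separation. -/

section Lagrange

/-- A finite family of convex functions whose maximum is at least `c` has a convex combination
that is at least `c`. -/
lemma exists_weights_le_sum {E ι : Type*} [AddCommGroup E] [Module ℝ E] [Fintype ι]
    {X : Set E} (hX : X.Nonempty) {f : ι → E → ℝ} (hf : ∀ i, ConvexOn ℝ X (f i)) {c : ℝ}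
    (hc : ∀ x ∈ X, ∃ i, c ≤ f i x) :
    ∃ a : ι → ℝ, (∀ i, 0 ≤ a i) ∧ ∑ i, a i = 1 ∧ ∀ x ∈ X, c ≤ ∑ i, a i * f i x := by
  classical
  obtain ⟨x₀, hx₀⟩ := hX
  let C : Set (ι → ℝ) := {b | ∃ x ∈ X, ∀ i, f i x ≤ b i}
  have hC : Convex ℝ C := by
    rintro b ⟨x, hx, hb⟩ b' ⟨y, hy, hb'⟩ s t hs ht hst
    -- Convexity of `X` is read off any `hf i`; `hc` at `x₀` supplies an index.
    refine ⟨s • x + t • y, (hf (hc x₀ hx₀).choose).1 hx hy hs ht hst, fun i => ?_⟩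
    refine ((hf i).2 hx hy hs ht hst).trans ?_
    simp only [smul_eq_mul, Pi.add_apply, Pi.smul_apply]
    exact add_le_add (mul_le_mul_of_nonneg_left (hb i) hs) (mul_le_mul_of_nonneg_left (hb' i) ht)
  have hdisj : Disjoint (univ.pi fun _ : ι => Iio c) C := by
    refine disjoint_left.2 fun b hb => ?_
    rintro ⟨x, hx, hxb⟩
    obtain ⟨i, hi⟩ := hc x hx
    have h1 : b i < c := hb i (mem_univ i)
    linarith [hxb i]
  obtain ⟨L, u, hL1, hL2⟩ := geometric_hahn_banach_open (convex_pi fun _ _ => convex_Iio c)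
    (isOpen_set_pi finite_univ fun _ _ => isOpen_Iio) hC hdisj
  let a : ι → ℝ := fun i => L (Pi.single i 1)
  have hL : ∀ b, L b = ∑ i, a i * b i := fun b => by
    conv_lhs => rw [← Finset.univ_sum_single b]
    rw [map_sum]
    refine Finset.sum_congr rfl fun i _ => ?_
    have : Pi.single i (b i) = b i • (Pi.single i 1 : ι → ℝ) := by
      rw [← Pi.single_smul]; simp
    rw [this, map_smul, smul_eq_mul, mul_comm]
  have hfC : ∀ x ∈ X, u ≤ ∑ i, a i * f i x := fun x hx => by
    rw [← hL fun i => f i x]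
    exact hL2 _ ⟨x, hx, fun _ => le_rfl⟩
  have ha : ∀ i, 0 ≤ a i := fun i => by
    by_contra! hneg
    -- `C` is closed upwards, so a negative weight would drive the functional below `u` along
    -- coordinate `i`; this `t` is far enough.
    obtain ⟨t, ht⟩ : ∃ t : ℝ, t = max 0 ((∑ i, a i * f i x₀ - u + 1) / (-a i)) := ⟨_, rfl⟩
    have ht0 : 0 ≤ t := ht ▸ le_max_left _ _
    have h1 := hL2 ((fun j => f j x₀) + t • Pi.single i 1) ⟨x₀, hx₀, fun j => by
      have : 0 ≤ (Pi.single i 1 : ι → ℝ) j :=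
        (Pi.single_nonneg.2 zero_le_one : (0 : ι → ℝ) ≤ Pi.single i 1) j
      simpa using mul_nonneg ht0 this⟩
    rw [map_add, map_smul, hL fun j => f j x₀] at h1
    have h2 : (∑ i, a i * f i x₀ - u + 1) / (-a i) ≤ t := ht ▸ le_max_right _ _
    rw [div_le_iff₀ (by linarith)] at h2
    simp only [smul_eq_mul] at h1
    change u ≤ _ + t * a i at h1
    linarith
  have hsum : 0 < ∑ i, a i := by
    refine (Finset.sum_nonneg fun i _ => ha i).lt_of_ne fun h0 => ?_
    have hz : ∀ i, a i = 0 := fun i =>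
      (Finset.sum_eq_zero_iff_of_nonneg fun i _ => ha i).1 h0.symm i (Finset.mem_univ i)
    have h1 := hL1 (fun _ => c - 1) fun i _ => by simp
    have h2 := hfC x₀ hx₀
    rw [hL] at h1
    simp only [hz, zero_mul, Finset.sum_const_zero] at h1 h2
    linarith
  have hcu : c * ∑ i, a i ≤ u := by
    refine le_of_forall_pos_lt_add fun δ hδ => ?_
    have h1 := hL1 (fun _ => c - δ / ∑ i, a i) fun i _ => by simpa using div_pos hδ hsum
    rw [hL, ← Finset.sum_mul, mul_sub, mul_div_cancel₀ _ hsum.ne'] at h1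
    linarith
  refine ⟨fun i => a i / ∑ j, a j, fun i => div_nonneg (ha i) hsum.le, ?_, fun x hx => ?_⟩
  · rw [← Finset.sum_div, div_self hsum.ne']
  · have h1 := hcu.trans (hfC x hx)
    simp only [div_mul_eq_mul_div]
    rw [← Finset.sum_div, le_div_iff₀ hsum]
    exact h1

end Lagrange

end SAA

namespace SAA

/-! ### The function `Phi` and the deterministic comparison. -/

section Deterministic

variable {E : Type*} {m : ℕ}

/-- The function whose minimum over `X` is `Phi X g r`. -/
def maxShift (g : Fin (m + 1) → E → ℝ) (r : ℝ) (x : E) : ℝ :=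
  Finset.univ.sup' Finset.univ_nonempty
    (fun i : Fin (m + 1) => if i = 0 then g 0 x - r else g i x)

lemma le_Phi {X : Set E} {f : Fin (m + 1) → E → ℝ} (hX : X.Nonempty) {r c : ℝ}
    (h : ∀ x ∈ X, c ≤ maxShift f r x) : c ≤ Phi X f r :=
  le_csInf (hX.image _) (by rintro _ ⟨x, hx, rfl⟩; exact h x hx)

lemma le_maxShift_zero (f : Fin (m + 1) → E → ℝ) (r : ℝ) (x : E) : f 0 x - r ≤ maxShift f r x :=
  (Finset.le_sup' (fun i : Fin (m + 1) => if i = 0 then f 0 x - r else f i x)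
    (Finset.mem_univ 0)).trans_eq' (by simp)

variable [TopologicalSpace E] {X : Set E} {f : Fin (m + 1) → E → ℝ}

lemma continuous_maxShift (hf : ∀ i, Continuous (f i)) :
    Continuous fun q : ℝ × E => maxShift f q.1 q.2 := by
  refine Continuous.finset_sup'_apply Finset.univ_nonempty fun i _ => ?_
  split_ifs
  · exact ((hf 0).comp continuous_snd).sub continuous_fst
  · exact (hf i).comp continuous_snd

lemma Phi_le (hX : IsCompact X) (hf : ∀ i, Continuous (f i)) (r : ℝ) {x : E} (hx : x ∈ X) :
    Phi X f r ≤ maxShift f r x :=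
  csInf_le (hX.bddBelow_image
    ((continuous_maxShift hf).comp (Continuous.prodMk_right r)).continuousOn) ⟨x, hx, rfl⟩

lemma continuous_Phi (hX : IsCompact X) (hf : ∀ i, Continuous (f i)) : Continuous (Phi X f) :=
  hX.continuous_sInf (f := maxShift f) (continuous_maxShift hf)

lemma antitone_Phi (hX : IsCompact X) (hX' : X.Nonempty) (hf : ∀ i, Continuous (f i)) :
    Antitone (Phi X f) := fun r s hrs => le_Phi hX' fun x hx =>
  (Phi_le hX hf s hx).trans <| Finset.sup'_mono_fun fun i _ => by
    split_ifs <;> linarith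

/-- The threshold at which `Phi` takes the value `ε`. -/
lemma exists_Phi_eq (hX : IsCompact X) (hf : ∀ i, Continuous (f i)) {xs : E}
    (hxs : xs ∈ feasibleSet X f) {ε : ℝ} (hε : 0 ≤ ε) : ∃ r, Phi X f r = ε := by
  have hX' : X.Nonempty := ⟨xs, hxs.1⟩
  obtain ⟨C, hC⟩ := hX.bddBelow_image (hf 0).continuousOn
  have h1 : ε ≤ Phi X f (C - ε) := le_Phi hX' fun x hx => by
    have := le_maxShift_zero f (C - ε) x
    have := hC ⟨x, hx, rfl⟩
    linarith
  have h2 : Phi X f (f 0 xs) ≤ ε := by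
    refine (Phi_le hX hf _ hxs.1).trans (Finset.sup'_le _ _ fun i _ => ?_)
    cases i using Fin.cases with
    | zero => simpa using hε
    | succ i => simpa [Fin.succ_ne_zero] using (hxs.2 i).trans hε
  exact mem_range_of_exists_le_of_exists_ge (continuous_Phi hX hf) ⟨_, h2⟩ ⟨_, h1⟩

lemma exists_isMinOn_feasibleSet (hX : IsCompact X) (hf : ∀ i, Continuous (f i))
    (hfeas : (feasibleSet X f).Nonempty) :
    ∃ xs ∈ feasibleSet X f, IsMinOn (f 0) (feasibleSet X f) xs := by
  have hset : feasibleSet X f = X ∩ ⋂ i : Fin m, {x | f i.succ x ≤ 0} := by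
    ext x; simp [feasibleSet]
  have hcomp : IsCompact (feasibleSet X f) := by
    rw [hset]
    exact hX.inter_right (isClosed_iInter fun i => isClosed_le (hf _) continuous_const)
  exact hcomp.exists_isMinOn hfeas (hf 0).continuousOn

/-- Lagrange multipliers at the level `ε` of `Phi`. -/
lemma exists_multipliers {E : Type*} [NormedAddCommGroup E] [NormedSpace ℝ E] {X : Set E}
    {f : Fin (m + 1) → E → ℝ} (hX : IsCompact X)
    (hf : ∀ i, Continuous (f i)) (hconv : ∀ i, ConvexOn ℝ X (f i)) {xs : E}
    (hxs : xs ∈ feasibleSet X f) {ε : ℝ} (hε : 0 ≤ ε) :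
    ∃ (r : ℝ) (a : Fin (m + 1) → ℝ), (∀ ρ, ε < Phi X f ρ → ρ < r) ∧ (∀ i, 0 ≤ a i) ∧
      ∑ i, a i = 1 ∧ ∀ x ∈ X, ε ≤ ∑ i, a i * f i x - a 0 * r := by
  obtain ⟨r, hr⟩ := exists_Phi_eq hX hf hxs hε
  have hX' : X.Nonempty := ⟨xs, hxs.1⟩
  have hconv' : ∀ i, ConvexOn ℝ X fun x => if i = 0 then f 0 x - r else f i x := fun i => by
    by_cases hi : i = 0
    · simpa only [hi, if_true] using! (hconv 0).sub (concaveOn_const r (hconv 0).1)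
    · simpa only [hi, if_false] using! hconv i
  have hmax : ∀ x ∈ X, ∃ i, ε ≤ if i = 0 then f 0 x - r else f i x := fun x hx => by
    obtain ⟨i, -, hi⟩ := Finset.exists_mem_eq_sup' Finset.univ_nonempty
      (fun i : Fin (m + 1) => if i = 0 then f 0 x - r else f i x)
    exact ⟨i, by rw [← hi, ← hr]; exact Phi_le hX hf r hx⟩
  obtain ⟨a, ha, hsum, hle⟩ := exists_weights_le_sum hX' hconv' hmax
  refine ⟨r, a, fun ρ hρ => ?_, ha, hsum, fun x hx => ?_⟩
  · by_contra! h
    have := antitone_Phi hX hX' hf h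
    linarith
  · have := hle x hx
    rw [Fin.sum_univ_succ] at this ⊢
    simp only [if_true, Fin.succ_ne_zero, if_false] at this
    linarith

/-- A perturbed problem whose data are close to the true ones at two points, and which satisfies
an approximate optimality condition, has an optimal value that underestimates the true one. -/
lemma underestimates_of_close (hX : IsCompact X) {fN : Fin (m + 1) → E → ℝ}
    {κ Δ ε r : ℝ} {a : Fin (m + 1) → ℝ} {xs y : E} (hxs : xs ∈ feasibleSet X f)
    (hmin : IsMinOn (f 0) (feasibleSet X f) xs) (hy : y ∈ X)
    (hr : ∀ ρ, ε < Phi X f ρ → ρ < r) (ha : ∀ i, 0 ≤ a i) (hsum : ∑ i, a i = 1)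
    (hle : ∀ x ∈ X, ε ≤ ∑ i, a i * f i x - a 0 * r) (hcont : ContinuousOn (fN 0) X)
    (h1 : ∀ i, fN i xs ≤ f i xs + κ)
    (h2 : ∑ i, a i * f i y - κ ≤ ∑ i, a i * fN i y)
    (h3 : ∀ x ∈ X, ∑ i, a i * fN i y - Δ ≤ ∑ i, a i * fN i x)
    (hε : 2 * κ + Δ < ε) :
    ∃ ρ : ℝ, optVal X (fun i x => fN i x - κ) = (ρ : EReal) ∧ Underestimates X f ε ρ := by
  have hxsN : xs ∈ feasibleSet X fun i x => fN i x - κ :=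
    ⟨hxs.1, fun i => by linarith [h1 i.succ, hxs.2 i]⟩
  obtain ⟨C, hC⟩ := hX.bddBelow_image hcont
  have hup : optVal X (fun i x => fN i x - κ) ≤ ((fN 0 xs - κ : ℝ) : EReal) :=
    iInf₂_le (f := fun x _ => ((fN 0 x - κ : ℝ) : EReal)) xs hxsN
  have hlow : ((C - κ : ℝ) : EReal) ≤ optVal X (fun i x => fN i x - κ) :=
    le_iInf₂ fun x hx => EReal.coe_le_coe_iff.2 (by linarith [hC ⟨x, hx.1, rfl⟩])
  obtain ⟨ρ, hρ⟩ : ∃ ρ : ℝ, optVal X (fun i x => fN i x - κ) = (ρ : EReal) :=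
    ⟨_, (EReal.coe_toReal (ne_top_of_le_ne_top (EReal.coe_ne_top _) hup)
      (ne_bot_of_le_ne_bot (EReal.coe_ne_bot _) hlow)).symm⟩
  refine ⟨ρ, hρ, le_iInf₂ fun x hx => EReal.coe_le_coe_iff.2 ?_, ?_⟩
  · rw [hρ, EReal.coe_le_coe_iff] at hup
    have h4 : f 0 xs ≤ f 0 x := hmin hx
    linarith [h1 0]
  · by_contra! hcon
    -- An infimum below `r` yields a sample-feasible point of value below `r`, so the sample minimum
    -- need not be attained.
    have hlt := EReal.coe_lt_coe_iff.2 (hr ρ hcon)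
    rw [← hρ, optVal] at hlt
    simp only [iInf_lt_iff] at hlt
    obtain ⟨x, hx, hxr⟩ := hlt
    have hxr' : fN 0 x - κ < r := EReal.coe_lt_coe_iff.1 hxr
    have h4 := hle y hy
    have h5 := h3 x hx.1
    have h6 : ∑ i, a i * fN i x ≤ a 0 * (r + κ) + ∑ i : Fin m, a i.succ * κ := by
      rw [Fin.sum_univ_succ]
      refine add_le_add (mul_le_mul_of_nonneg_left (by linarith) (ha 0))
        (Finset.sum_le_sum fun i _ => mul_le_mul_of_nonneg_left ?_ (ha _))
      have := hx.2 i
      linarith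
    rw [← Finset.sum_mul] at h6
    rw [Fin.sum_univ_succ] at hsum
    have h7 : ∑ i : Fin m, a i.succ = 1 - a 0 := by linarith
    rw [h7] at h6
    linarith

end Deterministic

/-! ### Expectation functions and weighted combinations. -/

section Stochastic

variable {E : Type*} [NormedAddCommGroup E] [InnerProductSpace ℝ E]
  {k m : ℕ} {P : Measure (EuclideanSpace ℝ (Fin k))}
  {F : Fin (m + 1) → E → EuclideanSpace ℝ (Fin k) → ℝ}

lemma convexOn_mean {i : Fin (m + 1)} (hconv : ∀ᵐ z ∂P, ConvexOn ℝ univ fun x => F i x z)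
    (hint : ∀ x, Integrable (F i x) P) : ConvexOn ℝ univ (mean P F i) := by
  refine ⟨convex_univ, fun x _ y _ s t hs ht hst => ?_⟩
  simp only [mean, smul_eq_mul]
  rw [← integral_const_mul, ← integral_const_mul,
    ← integral_add ((hint x).const_mul s) ((hint y).const_mul t)]
  refine integral_mono_ae (hint _) (((hint x).const_mul s).add ((hint y).const_mul t)) ?_
  filter_upwards [hconv] with z hz
  exact hz.2 (mem_univ x) (mem_univ y) hs ht hst

/-- Uniqueness of the subgradients makes the set under the supremum finite, so the default value of
an unbounded `sSup` does not intervene. -/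
lemma dualNorm_le_lip {p : Seminorm ℝ E} {x : E} {z : EuclideanSpace ℝ (Fin k)}
    {g h : Fin (m + 1) → E}
    (hg : ∀ i, g i ∈ subdiff (fun y => F i y z) x) (hh : ∀ i, h i ∈ subdiff (mean P F i) x)
    (hgs : ∀ i, (subdiff (fun y => F i y z) x).Subsingleton)
    (hhs : ∀ i, (subdiff (mean P F i) x).Subsingleton) (i : Fin (m + 1)) :
    dualNorm p (g i - h i) ≤ lip p P F x z := by
  refine le_csSup ((finite_range fun j => dualNorm p (g j - h j)).bddAbove.mono ?_)
    ⟨i, g i, hg i, h i, hh i, rfl⟩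
  rintro r ⟨j, g', hg', h', hh', rfl⟩
  exact ⟨j, by rw [hgs j hg' (hg j), hhs j hh' (hh j)]⟩

/-- First-order optimality over a convex set in terms of subgradients. -/
lemma inner_sum_nonneg_of_isMinOn {ι : Type*} [Fintype ι] {X : Set E} (hX : Convex ℝ X)
    {f : ι → E → ℝ} {a : ι → ℝ} {y : E} (hy : y ∈ X)
    (hmin : IsMinOn (fun x => ∑ i, a i * f i x) X y) (hd : ∀ i, DifferentiableAt ℝ (f i) y)
    {h : ι → E} (hh : ∀ i, h i ∈ subdiff (f i) y) {x : E} (hx : x ∈ X) :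
    0 ≤ inner ℝ (∑ i, a i • h i) (x - y) := by
  have hder : HasFDerivAt (fun x => ∑ i, a i * f i x) (∑ i, a i • fderiv ℝ (f i) y) y :=
    HasFDerivAt.fun_sum fun i _ => (hd i).hasFDerivAt.const_mul (a i)
  have := hmin.localize.hasFDerivWithinAt_nonneg hder.hasFDerivWithinAt
    (sub_mem_posTangentConeAt_of_segment_subset (hX.segment_subset hy hx))
  rw [sum_apply] at this
  rw [sum_inner]
  refine this.trans_eq (Finset.sum_congr rfl fun i _ => ?_)
  rw [inner_smul_left, inner_eq_fderiv_of_mem_subdiff (hd i) (hh i)]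
  rfl

lemma sq_sum_mul_le {ι : Type*} [Fintype ι] {a b : ι → ℝ} (ha : ∀ i, 0 ≤ a i)
    (hsum : ∑ i, a i = 1) : (∑ i, a i * b i) ^ 2 ≤ ∑ i, a i * b i ^ 2 := by
  simpa using (even_two.convexOn_pow (𝕜 := ℝ)).map_sum_le (t := Finset.univ) (w := a) (p := b)
    (fun i _ => ha i) hsum fun i _ => mem_univ _

/-- Convex combinations preserve the bound `E exp (Y² / M²) ≤ e`. -/
lemma lintegral_exp_sq_sum_le {Z : Type*} [MeasurableSpace Z] {P : Measure Z} {ι : Type*}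
    [Fintype ι] {a : ι → ℝ} (ha : ∀ i, 0 ≤ a i) (hsum : ∑ i, a i = 1) {Y : ι → Z → ℝ}
    (hY : ∀ i, AEMeasurable (Y i) P) {M : ℝ}
    (hexp : ∀ i, ∫⁻ z, ENNReal.ofReal (Real.exp (Y i z ^ 2 / M ^ 2)) ∂P
      ≤ ENNReal.ofReal (Real.exp 1)) :
    ∫⁻ z, ENNReal.ofReal (Real.exp ((∑ i, a i * Y i z) ^ 2 / M ^ 2)) ∂P
      ≤ ENNReal.ofReal (Real.exp 1) := by
  have hpt : ∀ z, ENNReal.ofReal (Real.exp ((∑ i, a i * Y i z) ^ 2 / M ^ 2)) ≤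
      ∑ i, ENNReal.ofReal (a i) * ENNReal.ofReal (Real.exp (Y i z ^ 2 / M ^ 2)) := fun z => by
    have h1 : Real.exp ((∑ i, a i * Y i z) ^ 2 / M ^ 2)
        ≤ ∑ i, a i * Real.exp (Y i z ^ 2 / M ^ 2) := by
      have h2 := convexOn_exp.map_sum_le (t := Finset.univ) (w := a)
        (p := fun i => Y i z ^ 2 / M ^ 2) (fun i _ => ha i) hsum fun i _ => mem_univ _
      simp only [smul_eq_mul] at h2
      refine (Real.exp_le_exp.2 ?_).trans h2
      simp only [← mul_div_assoc]
      rw [← Finset.sum_div]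
      exact div_le_div_of_nonneg_right (sq_sum_mul_le ha hsum) (sq_nonneg M)
    refine (ENNReal.ofReal_le_ofReal h1).trans_eq ?_
    rw [ENNReal.ofReal_sum_of_nonneg fun i _ => mul_nonneg (ha i) (Real.exp_pos _).le]
    exact Finset.sum_congr rfl fun i _ => ENNReal.ofReal_mul (ha i)
  refine (lintegral_mono hpt).trans ?_
  have hmeas : ∀ i, AEMeasurable (fun z => ENNReal.ofReal (Real.exp (Y i z ^ 2 / M ^ 2))) P :=
    fun i => (Real.measurable_exp.comp_aemeasurable
      (((hY i).pow_const 2).div_const _)).ennreal_ofReal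
  rw [lintegral_finsetSum' _ fun i _ => (hmeas i).const_mul _]
  calc ∑ i, ∫⁻ z, ENNReal.ofReal (a i) * ENNReal.ofReal (Real.exp (Y i z ^ 2 / M ^ 2)) ∂P
      ≤ ∑ i, ENNReal.ofReal (a i) * ENNReal.ofReal (Real.exp 1) :=
        Finset.sum_le_sum fun i _ => by
          rw [lintegral_const_mul' _ _ ENNReal.ofReal_ne_top]
          exact mul_le_mul_right (hexp i) _
    _ = ENNReal.ofReal (Real.exp 1) := by
        rw [← Finset.sum_mul, ← ENNReal.ofReal_sum_of_nonneg fun i _ => ha i, hsum]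
        simp

end Stochastic

end SAA

namespace SAA

/-! ### Linearisation of the sample averages. -/

section SampleBounds

variable {E : Type*} {k m : ℕ} {F : Fin (m + 1) → E → EuclideanSpace ℝ (Fin k) → ℝ} {N : ℕ}

lemma sampleMean_sub_eq (hN : 1 ≤ N) (ζ : Fin N → EuclideanSpace ℝ (Fin k)) (i : Fin (m + 1))
    (x : E) (c : ℝ) :
    sampleMean F ζ i x - c = (1 / (N : ℝ)) * ∑ t, (F i x (ζ t) - c) := by
  have hN' : (N : ℝ) ≠ 0 := by positivity
  rw [sampleMean, Finset.sum_sub_distrib, Finset.sum_const, Finset.card_univ, Fintype.card_fin,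
    nsmul_eq_mul, mul_sub, one_div, inv_mul_cancel_left₀ hN']

lemma one_div_mul_le_div_sqrt (hN : 1 ≤ N) {b c : ℝ} (h : b ≤ c * √(N : ℝ)) :
    1 / (N : ℝ) * b ≤ c / √(N : ℝ) := by
  have hN' : (0 : ℝ) < N := by positivity
  have hs : 0 < √(N : ℝ) := Real.sqrt_pos.2 hN'
  rw [one_div_mul_eq_div, div_le_div_iff₀ hN' hs]
  have := mul_le_mul_of_nonneg_right h hs.le
  rwa [mul_assoc, Real.mul_self_sqrt hN'.le] at this

/-- A weighted sample problem is bounded below by its linearisation. -/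
lemma weighted_sampleMean_ge [NormedAddCommGroup E] [InnerProductSpace ℝ E]
    [FiniteDimensional ℝ E] {p : Seminorm ℝ E}
    (hp : ∀ x, p x = 0 → x = 0) {X : Set E} (hX : IsCompact X)
    {ζ : Fin N → EuclideanSpace ℝ (Fin k)} {a : Fin (m + 1) → ℝ} (ha : ∀ i, 0 ≤ a i) {x y : E}
    (hx : x ∈ X) (hy : y ∈ X) {g : Fin (m + 1) → EuclideanSpace ℝ (Fin k) → E}
    (hg : ∀ t i, g i (ζ t) ∈ subdiff (fun x => F i x (ζ t)) y) {h : Fin (m + 1) → E}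
    (hopt : 0 ≤ inner ℝ (∑ i, a i • h i) (x - y)) :
    ∑ i, a i * sampleMean F ζ i y - 1 / (N : ℝ) *
        (2 * radius p X * dualNorm p (∑ t, ∑ i, a i • (g i (ζ t) - h i)))
      ≤ ∑ i, a i * sampleMean F ζ i x := by
  have hterm : ∀ t, ∑ i, a i * F i y (ζ t) + inner ℝ (∑ i, a i • (g i (ζ t) - h i)) (x - y)
      ≤ ∑ i, a i * F i x (ζ t) := fun t => by
    -- Subtracting the mean slope only lowers the right side, by `hopt`; this centres the
    -- subgradients.
    have h1 : inner ℝ (∑ i, a i • (g i (ζ t) - h i)) (x - y)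
        ≤ ∑ i, a i * inner ℝ (g i (ζ t)) (x - y) := by
      simp only [smul_sub, Finset.sum_sub_distrib]
      rw [inner_sub_left, sum_inner]
      simp only [inner_smul_left, conj_trivial]
      linarith
    have h2 := Finset.sum_le_sum fun i (_ : i ∈ Finset.univ) =>
      mul_le_mul_of_nonneg_left (hg t i x) (ha i)
    simp only [mul_add, Finset.sum_add_distrib] at h2
    linarith
  have hsum := Finset.sum_le_sum fun t (_ : t ∈ Finset.univ) => hterm t
  rw [Finset.sum_add_distrib, ← sum_inner] at hsum
  have hdual : -(2 * radius p X * dualNorm p (∑ t, ∑ i, a i • (g i (ζ t) - h i)))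
      ≤ inner ℝ (∑ t, ∑ i, a i • (g i (ζ t) - h i)) (x - y) := by
    have h1 := inner_le_dualNorm_mul hp (∑ t, ∑ i, a i • (g i (ζ t) - h i)) (y - x)
    have h2 := mul_le_mul_of_nonneg_left (le_two_mul_radius (p := p) hX hy hx)
      (dualNorm_nonneg hp (∑ t, ∑ i, a i • (g i (ζ t) - h i)))
    rw [← neg_sub x y, inner_neg_right, neg_sub] at h1
    linarith
  have hmean : ∀ x, ∑ i, a i * sampleMean F ζ i x = 1 / (N : ℝ) * ∑ t, ∑ i, a i * F i x (ζ t) :=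
    fun x => by
      simp only [sampleMean]
      rw [Finset.sum_comm, Finset.mul_sum]
      refine Finset.sum_congr rfl fun i _ => ?_
      rw [← Finset.mul_sum]
      ring
  rw [hmean, hmean, ← mul_sub]
  exact mul_le_mul_of_nonneg_left (by linarith) (by positivity)

end SampleBounds

end SAA

/-! ### Assembly: bad events at `xs` and `y`, and the union bound. -/

theorem proposition4
    {E : Type*} [NormedAddCommGroup E] [InnerProductSpace ℝ E] [FiniteDimensional ℝ E]
    [MeasurableSpace E] [BorelSpace E]
    -- the norm, given by a seminorm that vanishes only at the origin, and its
    -- distance-generating function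
    (p : Seminorm ℝ E) (hp : ∀ x, p x = 0 → x = 0)
    (ω : E → ℝ) (hω : SAA.IsDistGen p ω)
    (X : Set E) (hXconv : Convex ℝ X) (hXcomp : IsCompact X)
    -- the distribution and the integrands
    {k m : ℕ} (P : Measure (EuclideanSpace ℝ (Fin k))) [IsProbabilityMeasure P]
    (F : Fin (m + 1) → E → EuclideanSpace ℝ (Fin k) → ℝ)
    (hFmeas : ∀ i, Measurable (fun q : E × P.support => F i q.1 q.2))
    (hFconv : ∀ i, ∀ z ∈ P.support, ConvexOn ℝ Set.univ (fun x => F i x z))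
    (hFint : ∀ i x, Integrable (F i x) P)
    (hdiff : ∀ i, ∀ x ∈ X, DifferentiableAt ℝ (SAA.mean P F i) x)
    (M₁ M₂ : ℝ) (hM₁ : 0 < M₁) (hM₂ : 0 < M₂)
    (hexp₁ : ∀ i, ∀ x ∈ X,
      ∫⁻ z, ENNReal.ofReal (Real.exp ((F i x z - SAA.mean P F i x) ^ 2 / M₁ ^ 2)) ∂P
        ≤ ENNReal.ofReal (Real.exp 1))
    (hexp₂ : ∀ x ∈ X,
      ∫⁻ z, ENNReal.ofReal (Real.exp (SAA.lip p P F x z ^ 2 / M₂ ^ 2)) ∂P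
        ≤ ENNReal.ofReal (Real.exp 1))
    (hfeas : (SAA.feasibleSet X (SAA.mean P F)).Nonempty)
    -- the parameters
    (N : ℕ) (hN : 1 ≤ N) (s lam μ : ℝ) (hs : 1 < s)
    (hlam : lam ∈ Set.Icc 0 (2 * √(SAA.tauStar * N)))
    (hμ : μ ∈ Set.Icc 0 (2 * √(SAA.tauStar * N)))
    (ε β : ℝ)
    (hε : 2 / √(N : ℝ) * (μ * M₁ +
        M₂ * SAA.radius p X * (SAA.Omega p ω / 2 * (1 + s ^ 2) + lam)) < ε)
    (hβ : β = Real.exp (-(N * (s ^ 2 - 1))) + Real.exp (-(lam ^ 2 / (4 * SAA.tauStar)))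
        + (m + 2) * Real.exp (-(μ ^ 2 / (4 * SAA.tauStar))))
    -- the sample: independent random vectors with law `P` on an arbitrary probability space
    {S : Type*} [MeasurableSpace S] (Pr : Measure S) [IsProbabilityMeasure Pr]
    (ξ : Fin N → S → EuclideanSpace ℝ (Fin k))
    (hlaw : ∀ t, HasLaw (ξ t) P Pr) (hindep : iIndepFun ξ Pr)
    -- the event that the optimal value of the shifted sample problem underestimates
    (A : Set S)
    (hA : A = {w | ∃ ρ : ℝ,
      SAA.optVal X
          (fun i x => SAA.sampleMean F (fun t => ξ t w) i x - μ * M₁ / √(N : ℝ)) = (ρ : EReal) ∧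
        SAA.Underestimates X (SAA.mean P F) ε ρ}) :
    ENNReal.ofReal (1 - β) ≤ Pr A ∧ Pr Aᶜ ≤ ENNReal.ofReal β := by

  have hN' : (0 : ℝ) < N := by exact_mod_cast hN
  set f := SAA.mean P F with hf
  set Λ := SAA.Omega p ω / 2 * (1 + s ^ 2) + lam with hΛ
  have hR := SAA.radius_nonneg (p := p) X
  have hΩ := SAA.Omega_nonneg p ω
  have hΛ0 : 0 ≤ Λ := add_nonneg (by positivity) hlam.1
  have hconv : ∀ i, ∀ᵐ z ∂P, ConvexOn ℝ Set.univ fun x => F i x z := fun i => by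
    filter_upwards [Measure.support_mem_ae (μ := P)] with z hz using hFconv i z hz
  have hfconv : ∀ i, ConvexOn ℝ Set.univ (f i) := fun i => SAA.convexOn_mean (hconv i) (hFint i)
  have hfcont : ∀ i, Continuous (f i) := fun i =>
    continuousOn_univ.1 ((hfconv i).continuousOn isOpen_univ)
  obtain ⟨xs, hxs, hxsmin⟩ := SAA.exists_isMinOn_feasibleSet hXcomp hfcont hfeas
  have hε0 : 0 ≤ ε := by
    refine le_trans ?_ hε.le
    have := hμ.1
    positivity
  obtain ⟨r, a, hr, ha, hasum, hle⟩ := SAA.exists_multipliers hXcomp hfcont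
    (fun i => (hfconv i).subset (Set.subset_univ X) hXconv) hxs hε0
  -- This point is determined by the expectations alone, so the vectors `ζ (ξ t w)` formed there are
  -- independent.
  obtain ⟨y, hy, hymin⟩ := hXcomp.exists_isMinOn ⟨xs, hxs.1⟩
    (f := fun x => ∑ i, a i * f i x)
    (continuous_finsetSum _ fun i _ => (hfcont i).const_mul (a i)).continuousOn
  have hdy : ∀ i, DifferentiableAt ℝ (f i) y := fun i => hdiff i y hy
  choose h hh using fun i => SAA.subdiff_nonempty (hfconv i) y
  have hgex : ∀ i z, ∃ g : E, ConvexOn ℝ Set.univ (fun x => F i x z) →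
      g ∈ SAA.subdiff (fun x => F i x z) y := fun i z => by
    by_cases hc : ConvexOn ℝ Set.univ fun x => F i x z
    · obtain ⟨g, hg⟩ := SAA.subdiff_nonempty hc y
      exact ⟨g, fun _ => hg⟩
    · exact ⟨0, fun h => absurd h hc⟩
  choose g hg using hgex
  have hgae : ∀ i, ∀ᵐ z ∂P, g i z ∈ SAA.subdiff (fun x => F i x z) y := fun i =>
    (hconv i).mono fun z hz => hg i z hz
  have hgmean : ∀ i v, Integrable (fun z => inner ℝ (g i z) v) P ∧
      ∫ z, inner ℝ (g i z) v ∂P = inner ℝ (h i) v := fun i v => by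
    obtain ⟨-, -, -, H⟩ :=
      SAA.exists_seq_tendsto_inner_subdiff (hconv i) (hFint i) (hdy i) v
    refine ⟨(H (g i) (hgae i)).1, ?_⟩
    rw [(H (g i) (hgae i)).2]
    exact (SAA.inner_eq_fderiv_of_mem_subdiff (hdy i) (hh i) v).symm
  let ζ : EuclideanSpace ℝ (Fin k) → E := fun z => ∑ i, a i • (g i z - h i)
  have hsec : SecondCountableTopology E := by
    have := FiniteDimensional.proper_real E
    infer_instance
  have hζmeas : AEMeasurable ζ P := Finset.aemeasurable_fun_sum _ fun i _ =>
    ((SAA.aemeasurable_of_mem_subdiff (hconv i) (hFint i) (hdy i) (hgae i)).sub_const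
      (h i)).const_smul (a i)
  have hζinner : ∀ v, (fun z => inner ℝ (ζ z) v)
      = fun z => ∑ i, a i * (inner ℝ (g i z) v - inner ℝ (h i) v) := fun v => by
    funext z
    simp only [ζ, sum_inner, inner_smul_left, inner_sub_left, conj_trivial]
  have hterm : ∀ v i, Integrable (fun z => a i * (inner ℝ (g i z) v - inner ℝ (h i) v)) P :=
    fun v i => ((hgmean i v).1.sub (integrable_const _)).const_mul _
  have hζint : ∀ v, Integrable (fun z => inner ℝ (ζ z) v) P := fun v => by
    rw [hζinner]
    exact integrable_finsetSum _ fun i _ => hterm v i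
  have hζmean : ∀ v, ∫ z, inner ℝ (ζ z) v ∂P = 0 := fun v => by
    rw [hζinner, integral_finsetSum _ fun i _ => hterm v i]
    refine Finset.sum_eq_zero fun i _ => ?_
    rw [integral_const_mul, integral_sub (hgmean i v).1 (integrable_const _), (hgmean i v).2]
    simp
  have hζexp : ∫⁻ z, ENNReal.ofReal (Real.exp (SAA.dualNorm p (ζ z) ^ 2 / M₂ ^ 2)) ∂P
      ≤ ENNReal.ofReal (Real.exp 1) := by
    refine (lintegral_mono_ae ?_).trans (hexp₂ y hy)
    filter_upwards [ae_all_iff.2 hgae, ae_all_iff.2 fun i =>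
      SAA.ae_subdiff_subsingleton (hconv i) (hFint i) (hdy i)] with z hz hzs
    refine ENNReal.ofReal_le_ofReal (Real.exp_le_exp.2 (div_le_div_of_nonneg_right ?_
      (sq_nonneg _)))
    refine pow_le_pow_left₀ (SAA.dualNorm_nonneg hp _) ?_ 2
    refine (SAA.dualNorm_sum_le hp _ _).trans ?_
    calc ∑ i, SAA.dualNorm p (a i • (g i z - h i))
        ≤ ∑ i, a i * SAA.lip p P F y z := Finset.sum_le_sum fun i _ =>
          (SAA.dualNorm_smul hp (ha i) _).trans (mul_le_mul_of_nonneg_left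
            (SAA.dualNorm_le_lip (g := fun i => g i z) (h := h) hz hh hzs
              (fun i u hu u' hu' => SAA.eq_of_mem_subdiff (hdy i) hu hu') i) (ha i))
      _ = SAA.lip p P F y z := by rw [← Finset.sum_mul, hasum, one_mul]
  have hYint : ∀ i x, Integrable (fun z => F i x z - f i x) P := fun i x =>
    (hFint i x).sub (integrable_const _)
  have hYmean : ∀ i x, ∫ z, (F i x z - f i x) ∂P = 0 := fun i x => by
    rw [integral_sub (hFint i x) (integrable_const _)]
    simp [hf, SAA.mean]
  let B : Fin (m + 1) → Set S := fun i =>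
    {w | μ * M₁ * √(N : ℝ) ≤ ∑ t, (F i xs (ξ t w) - f i xs)}
  -- At `y` only the weighted combination matters, hence one event; with the `m + 1` events at `xs`
  -- this gives the factor `m + 2`.
  let Y : EuclideanSpace ℝ (Fin k) → ℝ := fun z => -∑ i, a i * (F i y z - f i y)
  let B' : Set S := {w | μ * M₁ * √(N : ℝ) ≤ ∑ t, Y (ξ t w)}
  let D : Set S := {w | M₂ * √(N : ℝ) * Λ < SAA.dualNorm p (∑ t, ζ (ξ t w))}
  have hB : ∀ i, Pr (B i) ≤ ENNReal.ofReal (Real.exp (-(μ ^ 2 / (4 * SAA.tauStar)))) := fun i =>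
    SAA.measure_sum_tail hN hlaw hindep (hYint i xs) (hYmean i xs) hM₁ (hexp₁ i xs hxs.1) hμ
  have hB' : Pr B' ≤ ENNReal.ofReal (Real.exp (-(μ ^ 2 / (4 * SAA.tauStar)))) := by
    have hi : ∀ i ∈ (Finset.univ : Finset (Fin (m + 1))),
      Integrable (fun z => a i * (F i y z - f i y)) P := fun i _ => (hYint i y).const_mul _
    refine SAA.measure_sum_tail hN hlaw hindep (Y := Y)
      (integrable_finsetSum _ hi).neg ?_ hM₁ ?_ hμ
    · simp only [Y]
      rw [integral_neg, integral_finsetSum _ hi]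
      simp [integral_const_mul, hYmean]
    · simp only [Y, neg_sq]
      exact SAA.lintegral_exp_sq_sum_le ha hasum (Y := fun i z => F i y z - f i y)
        (fun i => (hYint i y).aemeasurable) fun i => hexp₁ i y hy
  have hD := SAA.measure_dualNorm_sum_tail hp hω hN hlaw hindep hζmeas hζint hζmean hM₂ hζexp
    hlam s
  have hae : ∀ᵐ w ∂Pr, ∀ t i, ConvexOn ℝ Set.univ fun x => F i x (ξ t w) := by
    refine ae_all_iff.2 fun t => ae_of_ae_map (hlaw t).aemeasurable
      (p := fun z => ∀ i, ConvexOn ℝ Set.univ fun x => F i x z) ?_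
    rw [(hlaw t).map_eq]
    exact ae_all_iff.2 hconv
  have hgood : ∀ w, (∀ t i, ConvexOn ℝ Set.univ fun x => F i x (ξ t w)) →
      w ∉ (⋃ i, B i) ∪ B' ∪ D → w ∈ A := by
    intro w hw hwn
    simp only [Set.mem_union, Set.mem_iUnion, not_or, not_exists] at hwn
    obtain ⟨⟨hw1, hw2⟩, hw3⟩ := hwn
    rw [hA]
    refine SAA.underestimates_of_close hXcomp
      (Δ := 1 / (N : ℝ) * (2 * SAA.radius p X * (M₂ * √(N : ℝ) * Λ))) hxs hxsmin hy hr ha hasum hle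
      ?_ (fun i => ?_) ?_ (fun x hx => ?_) ?_
    · have : Continuous fun x => ∑ t, F 0 x (ξ t w) := continuous_finsetSum _ fun t _ =>
        continuousOn_univ.1 ((hw t 0).continuousOn isOpen_univ)
      exact (this.const_mul _).continuousOn
    · rw [← sub_le_iff_le_add', SAA.sampleMean_sub_eq hN]
      exact SAA.one_div_mul_le_div_sqrt hN (not_le.1 (hw1 i)).le
    · rw [sub_le_comm, ← Finset.sum_sub_distrib]
      refine le_trans (le_of_eq ?_) (SAA.one_div_mul_le_div_sqrt hN (not_le.1 hw2).le)
      simp only [Y, Finset.sum_neg_distrib]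
      rw [Finset.sum_comm, mul_neg, Finset.mul_sum, ← Finset.sum_neg_distrib]
      refine Finset.sum_congr rfl fun i _ => ?_
      rw [← Finset.mul_sum, ← mul_sub, mul_left_comm, ← SAA.sampleMean_sub_eq hN]
      ring
    · refine le_trans ?_ (SAA.weighted_sampleMean_ge (p := p) hp hXcomp ha hx hy
        (fun t i => hg i _ (hw t i))
        (SAA.inner_sum_nonneg_of_isMinOn hXconv hy hymin hdy hh hx))
      have h1 : SAA.dualNorm p (∑ t, ζ (ξ t w)) ≤ M₂ * √(N : ℝ) * Λ := not_lt.1 hw3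
      have h2 := mul_le_mul_of_nonneg_left h1 (mul_nonneg zero_le_two hR)
      exact sub_le_sub_left (mul_le_mul_of_nonneg_left h2 (by positivity)) _
    · refine lt_of_eq_of_lt ?_ hε
      have hsq := Real.sq_sqrt hN'.le
      nth_rewrite 2 [← hsq]
      field_simp
  have hβ0 : 0 ≤ β := by rw [hβ]; positivity
  have hcompl : Pr Aᶜ ≤ ENNReal.ofReal β := by
    have hsub : Aᶜ ≤ᵐ[Pr] ((⋃ i, B i) ∪ B' ∪ D : Set S) := by
      filter_upwards [hae] with w hw hwA
      by_contra hwn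
      exact hwA (hgood w hw hwn)
    calc Pr Aᶜ ≤ Pr ((⋃ i, B i) ∪ B' ∪ D) := measure_mono_ae hsub
      _ ≤ (∑ i, Pr (B i) + Pr B') + Pr D :=
        (measure_union_le _ _).trans (add_le_add_left ((measure_union_le _ _).trans
          (add_le_add_left (measure_iUnion_fintype_le _ _) _)) _)
      _ ≤ (∑ _i : Fin (m + 1), ENNReal.ofReal (Real.exp (-(μ ^ 2 / (4 * SAA.tauStar)))) +
            ENNReal.ofReal (Real.exp (-(μ ^ 2 / (4 * SAA.tauStar))))) +
          (ENNReal.ofReal (Real.exp (-(N * (s ^ 2 - 1)))) +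
            ENNReal.ofReal (Real.exp (-(lam ^ 2 / (4 * SAA.tauStar))))) :=
        add_le_add (add_le_add (Finset.sum_le_sum fun i _ => hB i) hB') hD
      _ = ENNReal.ofReal β := by
        rw [← ENNReal.ofReal_sum_of_nonneg fun _ _ => (Real.exp_pos _).le,
          ← ENNReal.ofReal_add (by positivity) (by positivity),
          ← ENNReal.ofReal_add (by positivity) (by positivity),
          ← ENNReal.ofReal_add (by positivity) (by positivity), hβ]
        congr 1
        simp only [Finset.sum_const, Finset.card_univ, Fintype.card_fin, nsmul_eq_mul]
        push_cast
        ring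
  refine ⟨?_, hcompl⟩
  rw [ENNReal.ofReal_sub 1 hβ0, ENNReal.ofReal_one, tsub_le_iff_right]
  -- Subadditivity suffices, so `A` need not be measurable.
  calc (1 : ENNReal) = Pr (A ∪ Aᶜ) := by rw [Set.union_compl_self, measure_univ]
    _ ≤ Pr A + Pr Aᶜ := measure_union_le _ _
    _ ≤ Pr A + ENNReal.ofReal β := by gcongr
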